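/- Notation. For $x\in\mathbb R$ let $[x]_\pm=\frac{|x|\pm x}{2}$. For $\nu\in\mathbb R$ put $p_F(\nu)=1+\frac2\nu$ if $\nu>0$ and $p_F(\nu)=+\infty$ if $\nu\le0$; $p_S(\nu)=\frac{\nu+1+\sqrt{\nu^2+10\nu-7}}{2(\nu-1)}$ if $\nu>1$ and $p_S(\nu)=+\infty$ if $\nu\le1$; $\gamma_F(p,\nu)=2-\nu(p-1)$; $\gamma_S(p,\nu)=2+(\nu+1)p-(\nu-1)p^2$. For an integer $n\ge1$ and $\mu\ge0$ put $\mu_*=\frac{n^2+n+2}{n+2}$ and $p_\mu(n)=\max\{p_F(n-[\mu-1]_-),\,p_S(n+\mu)\}$. Problem. For $\varepsilon>0$ consider $$u_{tt}-\Delta u+\frac{\mu}{1+t}u_t=|u|^p \ \text{ in } \mathbb R^n\times(0,T),\qquad u(x,0)=\varepsilon f(x),\quad u_t(x,0)=\varepsilon g(x).$$ An energy solution over $[0,T)$, $0<T\le\infty$, is a function $u\in C([0,T),H^1(\mathbb R^n))\cap C^1([0,T),L^2(\mathbb R^n))\cap C((0,T),L^p_{loc}(\mathbb R^n))$ that takes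 the initial data and satisfies, for all $\phi\in C_0^\infty(\mathbb R^n\times[0,T))$ and $t\in[0,T)$ (the time integral on the right being assumed to exist), $$\int u_t(x,t)\phi(x,t)\,dx-\int\varepsilon g(x)\phi(x,0)\,dx+\int_0^t\!\!\int\{-u_t\phi_t+\nabla u\cdot\nabla\phi\}\,dx\,ds+\int_0^t\!\!\int\frac{\mu}{1+s}u_t\phi\,dx\,ds=\int_0^t\!\!\int|u|^p\phi\,dx\,ds .$$ Theorem. Let $n\ge1$, $\mu\ge0$, $1<p<p_\mu(n)$ and $R\ge1$. Let $f\in H^1(\mathbb R^n)$ and $g\in L^2(\mathbb R^n)$ satisfy $f\ge0$ a.e., $f\not\equiv0$ (as an element of $L^2$), and $[\mu-1]_+f+g=0$ a.e. Let $T_\varepsilon$ be the lifespan, i.e. the supremum of all $T\in(0,\infty]$ for which there is an energy solution $u$ over $[0,T)$ with $\operatorname{supp}u\subset\{(x,t):|x|\le t+R\}$. Then there are constants $\varepsilon_3>0$ and $C>0$, depending only on $f,g,\mu,n,p,R$ (not on $\varepsilon$), such that for all $0<\varepsilon\le\varepsilon_3$: 1. if $0\le\mu\le\mu_*$, then $T_\varepsilon\le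 C\,\varepsilon^{-2p(p-1)/\gamma_S(p,n+\mu)}$; 2. if $\mu_*<\mu<n+3$, then with $p_*=1+\frac{n-\mu+3}{n+\mu-1}$: $T_\varepsilon\le C\,\varepsilon^{-2p(p-1)/\gamma_S(p,n+\mu)}$ if $1<p<p_*$; $T_\varepsilon\le C\,\sigma_0(\varepsilon)$ if $p=p_*$, where $\sigma_0=\sigma_0(\varepsilon)$ is the unique positive solution of $\varepsilon^p\,\sigma_0^{\frac2{p-1}-n}\ln(1+\sigma_0)=1$; $T_\varepsilon\le C\,\varepsilon^{-p(p-1)/\gamma_F(p,n)}$ if $p_*<p<p_\mu(n)$; 3. if $\mu\ge n+3$, then $T_\varepsilon\le C\,\varepsilon^{-p(p-1)/\gamma_F(p,n)}$; 4. if moreover $n=1$, $0<\mu<2$ and $1<p<\frac{2}{1+|\mu-1|}$, then also $T_\varepsilon\le C\,\varepsilon^{-(p-1)/\gamma_F(p,\,1+[\mu-1]_+)}$. -/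

import Mathlib

open MeasureTheory Filter Topology
open scoped ENNReal ContDiff

namespace DampedWave

noncomputable section

/-- The space `ℝⁿ` with its Euclidean norm. -/
abbrev Space (n : ℕ) : Type := EuclideanSpace ℝ (Fin n)

/-! ### Exponents -/

/-- The Fujita exponent `p_F(ν)`. -/
def fujitaExp (ν : ℝ) : EReal :=
  if 0 < ν then ((1 + 2 / ν : ℝ) : EReal) else ⊤

/-- The Strauss exponent `p_S(ν)`. -/
def straussExp (ν : ℝ) : EReal :=
  if 1 < ν then
    (((ν + 1 + Real.sqrt (ν ^ 2 + 10 * ν - 7)) / (2 * (ν - 1)) : ℝ) : EReal)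
  else ⊤

/-- `γ_F(p, ν) = 2 - ν (p - 1)`. -/
def gammaF (p ν : ℝ) : ℝ := 2 - ν * (p - 1)

/-- `γ_S(p, ν) = 2 + (ν + 1) p - (ν - 1) p²`. -/
def gammaS (p ν : ℝ) : ℝ := 2 + (ν + 1) * p - (ν - 1) * p ^ 2

/-- The threshold `μ_*(n) = (n² + n + 2) / (n + 2)`. -/
def muStar (n : ℕ) : ℝ := ((n : ℝ) ^ 2 + n + 2) / (n + 2)

/-- `p_μ(n) = max {p_F(n - [μ - 1]₋), p_S(n + μ)}`. -/
def critExp (n : ℕ) (μ : ℝ) : EReal :=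
  max (fujitaExp (n - (μ - 1)⁻)) (straussExp (n + μ))

/-- `p_* = 1 + (n - μ + 3) / (n + μ - 1)`; it is used only where `n + μ > 1`. -/
def pStar (n : ℕ) (μ : ℝ) : ℝ := 1 + (n - μ + 3) / (n + μ - 1)

/-- `s` is a positive solution of `ε ^ p * s ^ (2 / (p - 1) - n) * log (1 + s) = 1`. -/
def IsSigmaZero (n : ℕ) (p ε s : ℝ) : Prop :=
  0 < s ∧ ε ^ p * s ^ (2 / (p - 1) - n) * Real.log (1 + s) = 1

/-! ### Sobolev space `H¹(ℝⁿ)` -/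

/-- `G` is the weak gradient of `v` on `ℝⁿ` (both are meant to be locally integrable). -/
def HasWeakGradient {n : ℕ} (v : Space n → ℝ) (G : Space n → Space n) : Prop :=
  ∀ φ : Space n → ℝ, ContDiff ℝ ∞ φ → HasCompactSupport φ →
    ∫ x, v x • gradient φ x = - ∫ x, φ x • G x

/-- `v ∈ H¹(ℝⁿ)`: `v` is square integrable and has a square integrable weak gradient. -/
def MemH1 {n : ℕ} (v : Space n → ℝ) : Prop :=
  MemLp v 2 volume ∧ ∃ G : Space n → Space n, MemLp G 2 volume ∧ HasWeakGradient v G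

/-! ### Energy solutions -/

/-- The time interval `[0, T)`, with `T ∈ [0, ∞]`. -/
def timeInterval (T : ℝ≥0∞) : Set ℝ := {t : ℝ | 0 ≤ t ∧ ENNReal.ofReal t < T}

/-- Test functions in `C_0^∞(ℝⁿ × [0, T))`, given as restrictions of smooth compactly supported
functions on `ℝⁿ × (-∞, T)`. They need not vanish at time `0`. -/
structure IsTestFunction {n : ℕ} (T : ℝ≥0∞) (φ : Space n × ℝ → ℝ) : Prop where
  smooth : ContDiff ℝ ∞ φ
  compact_support : HasCompactSupport φ
  support_lt : ∀ z ∈ tsupport φ, ENNReal.ofReal z.2 < T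

/-- `u` is an energy solution over `[0, T)` of
`u_tt - Δ u + μ / (1 + t) u_t = |u|^p`, `u(x, 0) = ε f(x)`, `u_t(x, 0) = ε g(x)`.
The function `t ↦ u(t)` takes values in `L²(ℝⁿ)`; `v` is its time derivative, and `G` its spatial
gradient; on `[0, T)` both are determined by `u`. -/
structure IsEnergySolution {n : ℕ} (μ p ε : ℝ) (f g : Space n → ℝ) (T : ℝ≥0∞)
    (u v : ℝ → Lp ℝ 2 (volume : Measure (Space n)))
    (G : ℝ → Lp (Space n) 2 (volume : Measure (Space n))) : Prop where
  /-- the interval `[0, T)` is nonempty -/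
  T_pos : 0 < T
  /-- `u ∈ C([0, T), H¹)`: the weak gradient of `u(t)` is `G(t) ∈ L²`, and `u`, `G` are continuous
  with values in `L²` -/
  weak_gradient : ∀ t ∈ timeInterval T, HasWeakGradient (u t) (G t)
  continuous_u : ContinuousOn u (timeInterval T)
  continuous_grad : ContinuousOn G (timeInterval T)
  /-- `u ∈ C¹([0, T), L²)` with time derivative `v` -/
  hasDeriv : ∀ t ∈ timeInterval T, HasDerivWithinAt u (v t) (timeInterval T) t
  continuous_v : ContinuousOn v (timeInterval T)
  /-- `u ∈ C((0, T), L^p_loc)` -/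
  memLp_loc : ∀ t ∈ timeInterval T, 0 < t → ∀ K : Set (Space n), IsCompact K →
    MemLp (u t) (ENNReal.ofReal p) (volume.restrict K)
  continuous_Lp_loc : ∀ t ∈ timeInterval T, 0 < t → ∀ K : Set (Space n), IsCompact K →
    Tendsto (fun s => eLpNorm (fun x => u s x - u t x) (ENNReal.ofReal p) (volume.restrict K))
      (𝓝 t) (𝓝 0)
  /-- initial data -/
  initial_u : ∀ᵐ x, u 0 x = ε * f x
  initial_v : ∀ᵐ x, v 0 x = ε * g x
  /-- the time integral of the nonlinear term exists -/
  integrable_nonlinearity : ∀ φ : Space n × ℝ → ℝ, IsTestFunction T φ → ∀ t ∈ timeInterval T,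
    IntervalIntegrable (fun s => ∫ x, |u s x| ^ p * φ (x, s)) volume 0 t
  /-- the energy identity -/
  energy_identity : ∀ φ : Space n × ℝ → ℝ, IsTestFunction T φ → ∀ t ∈ timeInterval T,
    (∫ x, v t x * φ (x, t)) - (∫ x, ε * g x * φ (x, 0))
      + (∫ s in (0 : ℝ)..t, ∫ x,
          (-(v s x) * deriv (fun τ => φ (x, τ)) s
            + inner ℝ (G s x) (gradient (fun y => φ (y, s)) x)))
      + (∫ s in (0 : ℝ)..t, ∫ x, μ / (1 + s) * v s x * φ (x, s))
    = ∫ s in (0 : ℝ)..t, ∫ x, |u s x| ^ p * φ (x, s)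

/-- `supp u ⊆ {(x, t) : |x| ≤ t + R}` on `ℝⁿ × [0, T)`. -/
def SupportedInCone {n : ℕ} (R : ℝ) (T : ℝ≥0∞)
    (u : ℝ → Lp ℝ 2 (volume : Measure (Space n))) : Prop :=
  ∀ t ∈ timeInterval T, ∀ᵐ x, t + R < ‖x‖ → u t x = 0

/-- The lifespan (blow-up time) `T_ε ∈ [0, ∞]`: the supremum of all `T ∈ (0, ∞]` such that an
energy solution with support in the cone `|x| ≤ t + R` exists over `[0, T)`. -/
def lifespan {n : ℕ} (μ p R : ℝ) (f g : Space n → ℝ) (ε : ℝ) : ℝ≥0∞ :=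
  sSup {T : ℝ≥0∞ | ∃ u v G, IsEnergySolution μ p ε f g T u v G ∧ SupportedInCone R T u}

end

end DampedWave

/-!
Testing the equation with cutoffs equal to `1` on the support cone shows that the average
`Y = ∫ u dx`, in the shifted time `s = 1 + t`, solves the damped equation `Y'' + (μ / s) Y' = r`
with `r ≥ c s ^ (-n (p - 1)) |Y| ^ p` by Hölder's inequality. The condition `[μ - 1]₊ f + g = 0`
makes the homogeneous solution `s ^ (-[μ - 1]₊)`, so `Y > 0`. A second average of `u`, against a
positive radial eigenfunction `Δψ = ψ`, also solves a damped equation, with an extra term `-Z`,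
and grows like `ε s ^ (-μ / 2) e ^ s`. As `ψ` lives in an annulus of bounded width on the cone,
Hölder's inequality turns this growth into `r ≥ c ε ^ p s ^ (n - 1 - (n + μ - 1) p / 2)`.
Integrating each lower bound for `r` gives a power lower bound for `Y`. In the damped equation
driven by `|Y| ^ p`, `Y` doubles over intervals of geometrically decreasing length once it is too
large, so the time up to which `Y` can exist is bounded by the size of its lower bound.
-/

open scoped Laplacian

namespace DampedWave

noncomputable section

/-! ### Second order equations with damping `μ / s` -/

lemma monotoneOn_Icc_of_hasDerivAt_nonneg {f f' : ℝ → ℝ} {a b : ℝ}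
    (hc : ContinuousOn f (Set.Icc a b)) (hd : ∀ x ∈ Set.Ioo a b, HasDerivAt f (f' x) x)
    (h0 : ∀ x ∈ Set.Ioo a b, 0 ≤ f' x) : MonotoneOn f (Set.Icc a b) := by
  refine monotoneOn_of_hasDerivWithinAt_nonneg (f' := f') (convex_Icc a b) hc ?_ ?_ <;>
    rw [interior_Icc]
  exacts [fun x hx => (hd x hx).hasDerivWithinAt, h0]

lemma continuousOn_rpow_Icc (c : ℝ) {a b : ℝ} (ha : 0 < a) :
    ContinuousOn (fun s : ℝ => s ^ c) (Set.Icc a b) :=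
  continuousOn_id.rpow_const fun _ hx => Or.inl (ha.trans_le hx.1).ne'

section PowerWeight

variable {μ s y z F : ℝ} {Y Z : ℝ → ℝ}

lemma hasDerivAt_rpow_mul (c : ℝ) (hs : 0 < s) (hY : HasDerivAt Y z s) :
    HasDerivAt (fun s => s ^ c * Y s) (s ^ c * (z + c / s * Y s)) s := by
  refine ((Real.hasDerivAt_rpow_const (p := c) (Or.inl hs.ne')).fun_mul hY).congr_deriv ?_
  rw [Real.rpow_sub_one hs.ne']
  ring

/-- The effect of the substitution `V = s ^ m Y`, `V' = s ^ m (Y' + m Y / s)` on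
`Y'' + (μ / s) Y' = F`: the damping becomes `μ - 2 m`, and a potential `m (m + 1 - μ) / s ^ 2`
appears, which vanishes for `m = 0` and for `m = μ - 1`. -/
lemma hasDerivAt_rpow_mul_deriv (m : ℝ) (hs : 0 < s) (hY : HasDerivAt Y (Z s) s)
    (hZ : HasDerivAt Z (F - μ / s * Z s) s) :
    HasDerivAt (fun s => s ^ m * (Z s + m / s * Y s))
      (s ^ m * F - m * (m + 1 - μ) / s ^ 2 * (s ^ m * Y s)
        - (μ - 2 * m) / s * (s ^ m * (Z s + m / s * Y s))) s := by
  have hdiv : HasDerivAt (fun s : ℝ => m / s) (m * -(s ^ 2)⁻¹) s :=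
    (hasDerivAt_inv hs.ne').const_mul m
  refine (hasDerivAt_rpow_mul m hs (hZ.fun_add (hdiv.fun_mul hY))).congr_deriv ?_
  field_simp
  ring

end PowerWeight

/-- `Y'' + (μ / s) Y' = l Y + r` on `(1, b)` with `Y' = Z` and `0 ≤ r`. The spatial averages of an
energy solution satisfy such an equation in the time variable `s = 1 + t`. -/
structure DampedODE (μ l b : ℝ) (Y Z r : ℝ → ℝ) : Prop where
  cont : ContinuousOn Y (Set.Icc 1 b)
  cont_deriv : ContinuousOn Z (Set.Icc 1 b)
  hasDerivAt : ∀ s ∈ Set.Ioo 1 b, HasDerivAt Y (Z s) s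
  hasDerivAt_deriv : ∀ s ∈ Set.Ioo 1 b, HasDerivAt Z (l * Y s + r s - μ / s * Z s) s
  nonneg : ∀ s ∈ Set.Ioo 1 b, 0 ≤ r s

namespace DampedODE

variable {μ l b : ℝ} {Y Z r : ℝ → ℝ}

lemma mono (h : DampedODE μ l b Y Z r) {b' : ℝ} (hb : b' ≤ b) : DampedODE μ l b' Y Z r where
  cont := h.cont.mono (Set.Icc_subset_Icc_right hb)
  cont_deriv := h.cont_deriv.mono (Set.Icc_subset_Icc_right hb)
  hasDerivAt s hs := h.hasDerivAt s ⟨hs.1, hs.2.trans_le hb⟩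
  hasDerivAt_deriv s hs := h.hasDerivAt_deriv s ⟨hs.1, hs.2.trans_le hb⟩
  nonneg s hs := h.nonneg s ⟨hs.1, hs.2.trans_le hb⟩

lemma hasDerivAt_integratingFactor (h : DampedODE μ l b Y Z r) {s : ℝ} (hs : s ∈ Set.Ioo 1 b) :
    HasDerivAt (fun s => s ^ μ * Z s) (s ^ μ * (l * Y s + r s)) s :=
  (hasDerivAt_rpow_mul μ (one_pos.trans hs.1) (h.hasDerivAt_deriv s hs)).congr_deriv (by ring)

lemma deriv_nonneg (h : DampedODE μ l b Y Z r) (h1 : 0 ≤ Z 1)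
    (hl : ∀ s ∈ Set.Ioo 1 b, 0 ≤ l * Y s) : ∀ s ∈ Set.Icc 1 b, 0 ≤ Z s := by
  intro s hs
  have hmono : MonotoneOn (fun s => s ^ μ * Z s) (Set.Icc 1 b) :=
    monotoneOn_Icc_of_hasDerivAt_nonneg ((continuousOn_rpow_Icc μ one_pos).mul h.cont_deriv)
      (fun x hx => h.hasDerivAt_integratingFactor hx)
      fun x hx => mul_nonneg (Real.rpow_nonneg (one_pos.trans hx.1).le _)
        (add_nonneg (hl x hx) (h.nonneg x hx))
  have hle : Z 1 ≤ s ^ μ * Z s := by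
    simpa using hmono (Set.left_mem_Icc.2 (hs.1.trans hs.2)) hs hs.1
  exact nonneg_of_mul_nonneg_right (h1.trans hle) (Real.rpow_pos_of_pos (one_pos.trans_le hs.1) _)

lemma monotoneOn (h : DampedODE μ l b Y Z r) (h1 : 0 ≤ Z 1)
    (hl : ∀ s ∈ Set.Ioo 1 b, 0 ≤ l * Y s) : MonotoneOn Y (Set.Icc 1 b) :=
  monotoneOn_Icc_of_hasDerivAt_nonneg h.cont h.hasDerivAt
    fun s hs => h.deriv_nonneg h1 hl s (Set.Ioo_subset_Icc_self hs)

lemma half_initial_lt (h : DampedODE μ l b Y Z r) (hl : 0 ≤ l) (hY : 0 < Y 1) (hZ : 0 ≤ Z 1) :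
    ∀ s ∈ Set.Icc 1 b, Y 1 / 2 < Y s := by
  by_contra! ⟨x, hx, hYx⟩
  -- at the first point where `Y ≤ Y 1 / 2`, the function has been increasing so far
  have hcompact : IsCompact (Set.Icc 1 b ∩ Y ⁻¹' Set.Iic (Y 1 / 2)) :=
    isCompact_Icc.of_isClosed_subset (h.cont.preimage_isClosed_of_isClosed isClosed_Icc
      isClosed_Iic) Set.inter_subset_left
  obtain ⟨y, ⟨hy, hYy⟩, hleast⟩ := hcompact.exists_isLeast ⟨x, hx, hYx⟩
  have hpos : ∀ s ∈ Set.Ioo 1 y, 0 ≤ l * Y s := by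
    intro s hs
    refine mul_nonneg hl ?_
    by_contra! hneg
    have : y ≤ s := hleast ⟨⟨hs.1.le, hs.2.le.trans hy.2⟩, hneg.le.trans (half_pos hY).le⟩
    exact this.not_gt hs.2
  have hle : Y 1 ≤ Y y := (h.mono hy.2).monotoneOn hZ hpos (Set.left_mem_Icc.2 hy.1)
    (Set.right_mem_Icc.2 hy.1) hy.1
  exact (hle.trans hYy).not_gt (half_lt_self hY)

lemma initial_le (h : DampedODE μ l b Y Z r) (hl : 0 ≤ l) (hY : 0 < Y 1) (hZ : 0 ≤ Z 1) :
    ∀ s ∈ Set.Icc 1 b, Y 1 ≤ Y s := by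
  intro s hs
  have hpos : ∀ x ∈ Set.Ioo 1 b, 0 ≤ l * Y x := fun x hx => mul_nonneg hl
    ((half_pos hY).trans (h.half_initial_lt hl hY hZ x (Set.Ioo_subset_Icc_self hx))).le
  exact h.monotoneOn hZ hpos (Set.left_mem_Icc.2 (hs.1.trans hs.2)) hs hs.1

lemma rpow_mul {m : ℝ} (hm : m * (m + 1 - μ) = 0) (h : DampedODE μ l b Y Z r) :
    DampedODE (μ - 2 * m) l b (fun s => s ^ m * Y s) (fun s => s ^ m * (Z s + m / s * Y s))
      (fun s => s ^ m * r s) where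
  cont := (continuousOn_rpow_Icc m one_pos).mul h.cont
  cont_deriv := (continuousOn_rpow_Icc m one_pos).mul (h.cont_deriv.add
    ((continuousOn_const.div continuousOn_id fun _ hx => (one_pos.trans_le hx.1).ne').mul h.cont))
  hasDerivAt s hs := hasDerivAt_rpow_mul m (one_pos.trans hs.1) (h.hasDerivAt s hs)
  hasDerivAt_deriv s hs :=
    (hasDerivAt_rpow_mul_deriv m (one_pos.trans hs.1) (h.hasDerivAt s hs)
      (h.hasDerivAt_deriv s hs)).congr_deriv (by rw [hm]; ring)
  nonneg s hs := mul_nonneg (Real.rpow_nonneg (one_pos.trans hs.1).le _) (h.nonneg s hs)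

end DampedODE

/-! ### Exponential growth -/

/-- `V' + V` for the Liouville substitution `V = s ^ (κ / 2) Y`, where `Z = Y'`. If
`Y'' + (κ / s) Y' = Y`, then `V'' = V` up to a potential of size `s ^ (-2)`, so this function is
comparable to `e ^ s`. -/
def liouvilleSum (κ : ℝ) (Y Z : ℝ → ℝ) (s : ℝ) : ℝ :=
  s ^ (κ / 2) * (Z s + κ / 2 / s * Y s) + s ^ (κ / 2) * Y s

section Liouville

variable {κ s r : ℝ} {Y Z : ℝ → ℝ}

lemma hasDerivAt_liouvilleSum (hs : 0 < s) (hY : HasDerivAt Y (Z s) s)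
    (hZ : HasDerivAt Z (Y s + r - κ / s * Z s) s) :
    HasDerivAt (liouvilleSum κ Y Z) (liouvilleSum κ Y Z s
      + κ / 2 * (κ / 2 - 1) / s ^ 2 * (s ^ (κ / 2) * Y s) + s ^ (κ / 2) * r) s := by
  refine ((hasDerivAt_rpow_mul_deriv (κ / 2) hs hY hZ).fun_add
    (hasDerivAt_rpow_mul (κ / 2) hs hY)).congr_deriv ?_
  simp only [liouvilleSum]
  ring

lemma le_liouvilleSum (hκ : 0 ≤ κ) (hs : 0 < s) (hY : 0 ≤ Y s) (hZ : 0 ≤ Z s) :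
    s ^ (κ / 2) * Y s ≤ liouvilleSum κ Y Z s := by
  have : 0 ≤ s ^ (κ / 2) * (Z s + κ / 2 / s * Y s) := by positivity
  simpa only [liouvilleSum, le_add_iff_nonneg_left] using this

lemma half_rpow_mul_le_liouvilleSum (hκ : |κ| ≤ s) (hs : 0 < s) (hY : 0 ≤ Y s) (hZ : 0 ≤ Z s) :
    s ^ (κ / 2) * (Y s / 2) ≤ liouvilleSum κ Y Z s := by
  have hcoeff : -(1 / 2) ≤ κ / 2 / s := by
    rw [le_div_iff₀ hs]
    linarith [neg_abs_le κ]
  rw [liouvilleSum, ← mul_add]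
  gcongr
  nlinarith

lemma potential_mul_liouvilleSum_nonneg (hκ : |κ| ≤ s) (hs : 0 < s) (hY : 0 ≤ Y s)
    (hZ : 0 ≤ Z s) : 0 ≤ κ / 2 * (κ / 2 - 1) * (s ^ (κ / 2) * Y s)
      + |κ / 2 * (κ / 2 - 1)| * liouvilleSum κ Y Z s := by
  have : 0 ≤ s ^ (κ / 2) * Y s := by positivity
  rcases le_total 0 (κ / 2 * (κ / 2 - 1)) with hc | hc
  · have : 0 ≤ liouvilleSum κ Y Z s :=
      le_trans (by positivity) (half_rpow_mul_le_liouvilleSum hκ hs hY hZ)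
    positivity
  · have hκ0 : 0 ≤ κ := by nlinarith
    rw [abs_of_nonpos hc]
    nlinarith [mul_nonneg (neg_nonneg.2 hc) (sub_nonneg.2 (le_liouvilleSum hκ0 hs hY hZ))]

lemma hasDerivAt_exp_mul (C : ℝ) {W : ℝ → ℝ} {w : ℝ} (hs : 0 < s) (hW : HasDerivAt W w s) :
    HasDerivAt (fun s => Real.exp (-s - C / s) * W s)
      (Real.exp (-s - C / s) * (w - W s + C / s ^ 2 * W s)) s := by
  have hdiv : HasDerivAt (fun s : ℝ => C / s) (C * -(s ^ 2)⁻¹) s :=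
    (hasDerivAt_inv hs.ne').const_mul C
  refine (((hasDerivAt_neg s).fun_sub hdiv).exp.fun_mul hW).congr_deriv ?_
  ring

end Liouville

section GrowthLower

variable {κ b s₀ : ℝ} {Y Z r : ℝ → ℝ}

lemma DampedODE.exp_mul_liouvilleSum_monotoneOn (h : DampedODE κ 1 b Y Z r) (h1 : 1 ≤ s₀)
    (hκ : |κ| ≤ s₀) (hY : ∀ s ∈ Set.Icc 1 b, 0 ≤ Y s) (hZ : ∀ s ∈ Set.Icc 1 b, 0 ≤ Z s) :
    MonotoneOn (fun s => Real.exp (-s - |κ / 2 * (κ / 2 - 1)| / s) * liouvilleSum κ Y Z s)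
      (Set.Icc s₀ b) := by
  have hs₀ : 0 < s₀ := one_pos.trans_le h1
  have hsub : Set.Icc s₀ b ⊆ Set.Icc 1 b := Set.Icc_subset_Icc_left h1
  have hne : ∀ x ∈ Set.Icc s₀ b, x ≠ 0 := fun x hx => (hs₀.trans_le hx.1).ne'
  have hrpow := continuousOn_rpow_Icc (κ / 2) hs₀ (b := b)
  refine monotoneOn_Icc_of_hasDerivAt_nonneg ?_ (fun x hx => hasDerivAt_exp_mul _ (hs₀.trans hx.1)
    (hasDerivAt_liouvilleSum (hs₀.trans hx.1) (h.hasDerivAt x ⟨h1.trans_lt hx.1, hx.2⟩)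
      (by simpa using h.hasDerivAt_deriv x ⟨h1.trans_lt hx.1, hx.2⟩))) fun x hx => ?_
  · exact ((continuousOn_neg.sub (continuousOn_const.div continuousOn_id hne)).rexp).mul
      ((hrpow.mul ((h.cont_deriv.mono hsub).add ((continuousOn_const.div continuousOn_id hne).mul
        (h.cont.mono hsub)))).add (hrpow.mul (h.cont.mono hsub)))
  · have hx0 : 0 < x := hs₀.trans hx.1
    have hx1 := hsub (Set.Ioo_subset_Icc_self hx)
    have hpot := potential_mul_liouvilleSum_nonneg (hκ.trans hx.1.le) hx0 (hY x hx1) (hZ x hx1)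
    have hr : 0 ≤ x ^ (κ / 2) * r x :=
      mul_nonneg (by positivity) (h.nonneg x ⟨h1.trans_lt hx.1, hx.2⟩)
    refine mul_nonneg (Real.exp_pos _).le
      ((add_nonneg (div_nonneg hpot (sq_nonneg x)) hr).trans_eq ?_)
    ring

lemma DampedODE.mul_exp_le_liouvilleSum (h : DampedODE κ 1 b Y Z r) (h1 : 1 ≤ s₀) (hκ : |κ| ≤ s₀)
    (hY1 : 0 < Y 1) (hZ1 : 0 ≤ Z 1) : ∀ s ∈ Set.Icc s₀ b,
      2 * (s₀ ^ (κ / 2) * (Y 1 / 4) * Real.exp (-s₀ - |κ / 2 * (κ / 2 - 1)|)) * Real.exp s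
        ≤ liouvilleSum κ Y Z s := by
  intro s hs
  set C : ℝ := |κ / 2 * (κ / 2 - 1)|
  have hY := h.initial_le zero_le_one hY1 hZ1
  have hY0 : ∀ s ∈ Set.Icc 1 b, 0 ≤ Y s := fun s hs => hY1.le.trans (hY s hs)
  have hZ0 := h.deriv_nonneg hZ1 fun s hs => by simpa using hY0 s (Set.Ioo_subset_Icc_self hs)
  have hs₀ : 0 < s₀ := one_pos.trans_le h1
  have hs₀b : s₀ ∈ Set.Icc 1 b := ⟨h1, hs.1.trans hs.2⟩
  have hstart : s₀ ^ (κ / 2) * (Y 1 / 2) ≤ liouvilleSum κ Y Z s₀ :=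
    le_trans (by gcongr; exact hY s₀ hs₀b)
      (half_rpow_mul_le_liouvilleSum hκ hs₀ (hY0 s₀ hs₀b) (hZ0 s₀ hs₀b))
  have hmono := h.exp_mul_liouvilleSum_monotoneOn h1 hκ hY0 hZ0
    (Set.left_mem_Icc.2 (hs.1.trans hs.2)) hs hs.1
  have : 0 ≤ liouvilleSum κ Y Z s₀ := le_trans (by positivity) hstart
  have hC : C / s₀ ≤ C := div_le_self (abs_nonneg _) h1
  have hCs : 0 ≤ C / s := div_nonneg (abs_nonneg _) (hs₀.le.trans hs.1)
  calc _ = Real.exp (-s₀ - C) * (s₀ ^ (κ / 2) * (Y 1 / 2)) * Real.exp s := by ring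
    _ ≤ Real.exp (-s₀ - C / s₀) * liouvilleSum κ Y Z s₀ * Real.exp s := by gcongr
    _ ≤ Real.exp (-s - C / s) * liouvilleSum κ Y Z s * Real.exp s := by gcongr
    _ = Real.exp (-(C / s)) * liouvilleSum κ Y Z s := by
      rw [mul_right_comm, ← Real.exp_add]
      ring_nf
    _ ≤ 1 * liouvilleSum κ Y Z s := by
      have : Real.exp (-(C / s)) ≤ 1 := Real.exp_le_one_iff.2 (by linarith)
      have := (half_rpow_mul_le_liouvilleSum (hκ.trans hs.1) (hs₀.trans_le hs.1)
        (hY0 s ⟨h1.trans hs.1, hs.2⟩) (hZ0 s ⟨h1.trans hs.1, hs.2⟩))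
      gcongr
      refine le_trans (mul_nonneg ?_ ?_) this
      · exact Real.rpow_nonneg (hs₀.le.trans hs.1) _
      · exact div_nonneg (hY0 s ⟨h1.trans hs.1, hs.2⟩) two_pos.le
    _ = _ := one_mul _

lemma DampedODE.mul_exp_le_rpow_mul (h : DampedODE κ 1 b Y Z r) (h1 : 1 ≤ s₀) {a : ℝ}
    (hstart : a * Real.exp s₀ ≤ s₀ ^ (κ / 2) * Y s₀)
    (hW : ∀ s ∈ Set.Icc s₀ b, 2 * a * Real.exp s ≤ liouvilleSum κ Y Z s) :
    ∀ s ∈ Set.Icc s₀ b, a * Real.exp s ≤ s ^ (κ / 2) * Y s := by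
  intro s hs
  have hs₀ : 0 < s₀ := one_pos.trans_le h1
  have hmono : MonotoneOn (fun s => Real.exp s * (s ^ (κ / 2) * Y s - a * Real.exp s))
      (Set.Icc s₀ b) := by
    refine monotoneOn_Icc_of_hasDerivAt_nonneg
      (f' := fun s => Real.exp s * (liouvilleSum κ Y Z s - 2 * a * Real.exp s)) ?_
      (fun x hx => ?_) fun x hx => mul_nonneg (Real.exp_pos _).le
        (sub_nonneg.2 (hW x (Set.Ioo_subset_Icc_self hx)))
    · exact Real.continuous_exp.continuousOn.mul (((continuousOn_rpow_Icc (κ / 2) hs₀).mul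
        (h.cont.mono (Set.Icc_subset_Icc_left h1))).sub (by fun_prop))
    · refine ((Real.hasDerivAt_exp x).fun_mul ((hasDerivAt_rpow_mul (κ / 2) (hs₀.trans hx.1)
        (h.hasDerivAt x ⟨h1.trans_lt hx.1, hx.2⟩)).fun_sub
          ((Real.hasDerivAt_exp x).const_mul a))).congr_deriv ?_
      simp only [liouvilleSum]
      ring
  have hle := hmono (Set.left_mem_Icc.2 (hs.1.trans hs.2)) hs hs.1
  have h0 : 0 ≤ Real.exp s * (s ^ (κ / 2) * Y s - a * Real.exp s) :=
    (mul_nonneg (Real.exp_pos _).le (sub_nonneg.2 hstart)).trans hle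
  exact sub_nonneg.1 (nonneg_of_mul_nonneg_right h0 (Real.exp_pos _))

lemma rpow_neg_mul_exp_le {s : ℝ} (h1 : 1 ≤ s) (hs : s ≤ s₀) (κ : ℝ) :
    s ^ (-(κ / 2)) * Real.exp s ≤ s₀ ^ (|κ| / 2) * Real.exp s₀ := by
  have : 0 < s₀ := one_pos.trans_le (h1.trans hs)
  have hrpow : s ^ (-(κ / 2)) ≤ s₀ ^ (|κ| / 2) :=
    (Real.rpow_le_rpow_of_exponent_le h1 (by linarith [neg_abs_le κ])).trans
      (Real.rpow_le_rpow (by linarith) hs (by positivity))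
  gcongr

end GrowthLower

theorem DampedODE.exists_growth_lower (κ : ℝ) : ∃ c : ℝ, 0 < c ∧ ∀ (b : ℝ) (Y Z r : ℝ → ℝ),
    DampedODE κ 1 b Y Z r → 0 < Y 1 → 0 ≤ Z 1 → ∀ s ∈ Set.Icc 1 b,
      c * Y 1 * (s ^ (-(κ / 2)) * Real.exp s) ≤ Y s := by
  set s₀ : ℝ := max 1 |κ|
  have hs₀1 : 1 ≤ s₀ := le_max_left _ _
  have : 0 < s₀ := one_pos.trans_le hs₀1
  set M : ℝ := s₀ ^ (|κ| / 2) * Real.exp s₀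
  set a : ℝ := s₀ ^ (κ / 2) * (1 / 4) * Real.exp (-s₀ - |κ / 2 * (κ / 2 - 1)|)
  have hM : 0 < M := by positivity
  refine ⟨min M⁻¹ a, by positivity, fun b Y Z r h hY1 hZ1 s hs => ?_⟩
  have hs0 : 0 < s := one_pos.trans_le hs.1
  rcases le_total s s₀ with hss | hss
  · calc min M⁻¹ a * Y 1 * (s ^ (-(κ / 2)) * Real.exp s) ≤ M⁻¹ * Y 1 * M := by
          gcongr
          exacts [min_le_left _ _, rpow_neg_mul_exp_le hs.1 hss κ]
      _ = Y 1 := by field_simp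
      _ ≤ Y s := h.initial_le zero_le_one hY1 hZ1 s hs
  have hstart : a * Y 1 * Real.exp s₀ ≤ s₀ ^ (κ / 2) * Y s₀ := by
    have hexp : Real.exp (-s₀ - |κ / 2 * (κ / 2 - 1)|) * Real.exp s₀ ≤ 1 := by
      rw [← Real.exp_add]
      exact Real.exp_le_one_iff.2 (by linarith [abs_nonneg (κ / 2 * (κ / 2 - 1))])
    calc a * Y 1 * Real.exp s₀ = s₀ ^ (κ / 2) * (Y 1 / 4)
          * (Real.exp (-s₀ - |κ / 2 * (κ / 2 - 1)|) * Real.exp s₀) := by ring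
      _ ≤ s₀ ^ (κ / 2) * (Y 1 / 4) * 1 := by gcongr
      _ ≤ s₀ ^ (κ / 2) * Y s₀ := by
        rw [mul_one]
        gcongr
        linarith [h.initial_le zero_le_one hY1 hZ1 s₀ ⟨hs₀1, hss.trans hs.2⟩]
  have hlarge := h.mul_exp_le_rpow_mul hs₀1 hstart (fun x hx => le_of_eq_of_le (by ring)
    (h.mul_exp_le_liouvilleSum hs₀1 (le_max_right _ _) hY1 hZ1 x hx)) s ⟨hss, hs.2⟩
  calc min M⁻¹ a * Y 1 * (s ^ (-(κ / 2)) * Real.exp s)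
      ≤ a * Y 1 * (s ^ (-(κ / 2)) * Real.exp s) := by gcongr; exact min_le_right _ _
    _ = s ^ (-(κ / 2)) * (a * Y 1 * Real.exp s) := by ring
    _ ≤ s ^ (-(κ / 2)) * (s ^ (κ / 2) * Y s) := by gcongr
    _ = Y s := by rw [← mul_assoc, ← Real.rpow_add hs0, neg_add_cancel, Real.rpow_zero, one_mul]

theorem DampedODE.exists_growth_lower_of_initial {μ m : ℝ} (hm : m * (m + 1 - μ) = 0) :
    ∃ c : ℝ, 0 < c ∧ ∀ (b : ℝ) (Y Z r : ℝ → ℝ), DampedODE μ 1 b Y Z r → 0 < Y 1 →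
      Z 1 = -(m * Y 1) → ∀ s ∈ Set.Icc 1 b, c * Y 1 * (s ^ (-(μ / 2)) * Real.exp s) ≤ Y s := by
  obtain ⟨c, hc, hlower⟩ := DampedODE.exists_growth_lower (μ - 2 * m)
  refine ⟨c, hc, fun b Y Z r h hY hZ s hs => ?_⟩
  have hs0 : 0 < s := one_pos.trans_le hs.1
  have := hlower b _ _ _ (h.rpow_mul hm) (by simpa using hY) (by simp [hZ]) s hs
  simp only [Real.one_rpow, one_mul] at this
  rw [show -((μ - 2 * m) / 2) = m + -(μ / 2) by ring, Real.rpow_add hs0] at this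
  refine le_of_mul_le_mul_left ?_ (Real.rpow_pos_of_pos hs0 m)
  linarith

section GrowthUpper

variable {κ : ℝ} {Y Z : ℝ → ℝ}

lemma liouvilleSum_antitoneOn (hκ : 0 ≤ κ) (hY : ∀ s, 0 < s → HasDerivAt Y (Z s) s)
    (hZ : ∀ s, 0 < s → HasDerivAt Z (Y s - κ / s * Z s) s)
    (hY0 : ∀ s, 0 < s → 0 ≤ Y s) (hZ0 : ∀ s, 0 < s → 0 ≤ Z s) :
    AntitoneOn (fun s => Real.exp (-s + |κ / 2 * (κ / 2 - 1)| / s) * liouvilleSum κ Y Z s)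
      (Set.Ioi 0) := by
  have hderiv : ∀ s ∈ Set.Ioi (0 : ℝ), HasDerivAt (fun s =>
      Real.exp (-s + |κ / 2 * (κ / 2 - 1)| / s) * liouvilleSum κ Y Z s) _ s := fun s hs => by
    simpa only [neg_div, sub_neg_eq_add] using
      hasDerivAt_exp_mul (-|κ / 2 * (κ / 2 - 1)|) hs (hasDerivAt_liouvilleSum (r := 0) hs (hY s hs)
        (by simpa using hZ s hs))
  refine antitoneOn_of_hasDerivWithinAt_nonpos (convex_Ioi 0)
    (fun s hs => (hderiv s hs).continuousAt.continuousWithinAt)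
    (fun s hs => (hderiv s (interior_subset hs)).hasDerivWithinAt) fun s hs => ?_
  have hs0 : 0 < s := interior_subset hs
  have hpot : κ / 2 * (κ / 2 - 1) * (s ^ (κ / 2) * Y s)
      ≤ |κ / 2 * (κ / 2 - 1)| * liouvilleSum κ Y Z s := by
    have hV : 0 ≤ s ^ (κ / 2) * Y s := mul_nonneg (by positivity) (hY0 s hs0)
    gcongr
    exacts [le_abs_self _, le_liouvilleSum hκ hs0 (hY0 s hs0) (hZ0 s hs0)]
  refine mul_nonpos_of_nonneg_of_nonpos (Real.exp_pos _).le ?_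
  refine le_of_eq_of_le ?_ (div_nonpos_of_nonpos_of_nonneg (sub_nonpos.2 hpot) (sq_nonneg s))
  ring

lemma exists_le_exp_of_one_le (hκ : 0 ≤ κ) (hY : ∀ s, 0 < s → HasDerivAt Y (Z s) s)
    (hZ : ∀ s, 0 < s → HasDerivAt Z (Y s - κ / s * Z s) s)
    (hY0 : ∀ s, 0 < s → 0 ≤ Y s) (hZ0 : ∀ s, 0 < s → 0 ≤ Z s) :
    ∃ K : ℝ, ∀ s, 1 ≤ s → s ^ (κ / 2) * Y s ≤ K * Real.exp s := by
  refine ⟨Real.exp (-1 + |κ / 2 * (κ / 2 - 1)| / 1) * liouvilleSum κ Y Z 1, fun s hs => ?_⟩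
  have hs0 : 0 < s := one_pos.trans_le hs
  have hanti := liouvilleSum_antitoneOn hκ hY hZ hY0 hZ0 (Set.mem_Ioi.2 one_pos) hs0 hs
  have hV : 0 ≤ s ^ (κ / 2) * Y s := mul_nonneg (by positivity) (hY0 s hs0)
  calc s ^ (κ / 2) * Y s = Real.exp (-s) * (s ^ (κ / 2) * Y s) * Real.exp s := by
        rw [mul_right_comm, ← Real.exp_add, neg_add_cancel, Real.exp_zero, one_mul]
    _ ≤ Real.exp (-s + |κ / 2 * (κ / 2 - 1)| / s) * liouvilleSum κ Y Z s * Real.exp s := by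
        gcongr
        · exact le_add_of_nonneg_right (by positivity)
        · exact le_liouvilleSum hκ hs0 (hY0 s hs0) (hZ0 s hs0)
    _ ≤ _ := by gcongr

theorem exists_growth_upper (hκ : 0 ≤ κ) (hYc : ContinuousOn Y (Set.Icc 0 1))
    (hY : ∀ s, 0 < s → HasDerivAt Y (Z s) s)
    (hZ : ∀ s, 0 < s → HasDerivAt Z (Y s - κ / s * Z s) s)
    (hY0 : ∀ s, 0 < s → 0 ≤ Y s) (hZ0 : ∀ s, 0 < s → 0 ≤ Z s) :
    ∃ C : ℝ, 0 < C ∧ ∀ s, 0 ≤ s → Y s ≤ C * ((1 + s) ^ (-(κ / 2)) * Real.exp s) := by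
  obtain ⟨K, hK⟩ := exists_le_exp_of_one_le hκ hY hZ hY0 hZ0
  obtain ⟨D, hD⟩ := (isCompact_Icc (a := (0 : ℝ)) (b := 1)).bddAbove_image hYc
  set C : ℝ := max 1 (max D K)
  have hCD : D ≤ C := (le_max_left _ _).trans (le_max_right _ _)
  have hCK : K ≤ C := (le_max_right _ _).trans (le_max_right _ _)
  have : 0 < C := by positivity
  refine ⟨C * 2 ^ (κ / 2), by positivity, fun s hs => ?_⟩
  have htwo : ∀ x : ℝ, 0 < x → 1 + s ≤ 2 * x →
      1 ≤ x ^ (κ / 2) * (2 ^ (κ / 2) * (1 + s) ^ (-(κ / 2))) := fun x hx hsx => by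
    rw [mul_left_comm, ← mul_assoc, ← Real.mul_rpow two_pos.le hx.le, Real.rpow_neg (by linarith),
      ← div_eq_mul_inv, one_le_div (by positivity)]
    exact Real.rpow_le_rpow (by linarith) hsx (by positivity)
  rcases le_total s 1 with hs1 | hs1
  · calc Y s ≤ C := (hD ⟨s, ⟨hs, hs1⟩, rfl⟩).trans hCD
      _ = C * 1 * 1 := by ring
      _ ≤ C * (1 ^ (κ / 2) * (2 ^ (κ / 2) * (1 + s) ^ (-(κ / 2)))) * Real.exp s := by
        gcongr
        exacts [htwo 1 one_pos (by linarith), Real.one_le_exp hs]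
      _ = C * 2 ^ (κ / 2) * ((1 + s) ^ (-(κ / 2)) * Real.exp s) := by
        rw [Real.one_rpow]
        ring
  · have hs0 : 0 < s := one_pos.trans_le hs1
    calc Y s = Y s * 1 := (mul_one _).symm
      _ ≤ Y s * (s ^ (κ / 2) * (2 ^ (κ / 2) * (1 + s) ^ (-(κ / 2)))) := by
        have := hY0 s hs0
        gcongr
        exact htwo s hs0 (by linarith)
      _ = s ^ (κ / 2) * Y s * (2 ^ (κ / 2) * (1 + s) ^ (-(κ / 2))) := by ring
      _ ≤ C * Real.exp s * (2 ^ (κ / 2) * (1 + s) ^ (-(κ / 2))) := by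
        gcongr ?_ * _
        exact (hK s hs1).trans (by gcongr)
      _ = C * 2 ^ (κ / 2) * ((1 + s) ^ (-(κ / 2)) * Real.exp s) := by ring

end GrowthUpper

/-! ### Blow-up of solutions driven by a power -/

namespace DampedODE

variable {μ m b I : ℝ} {Y Z r : ℝ → ℝ}

lemma sub_mul_rpow (hm : m * (m + 1 - μ) = 0) (h : DampedODE μ 0 b Y Z r) (I : ℝ) :
    DampedODE μ 0 b (fun s => Y s - I * s ^ (-m)) (fun s => Z s + m * I * s ^ (-m - 1)) r where
  cont := h.cont.sub (continuousOn_const.mul (continuousOn_rpow_Icc _ one_pos))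
  cont_deriv := h.cont_deriv.add (continuousOn_const.mul (continuousOn_rpow_Icc _ one_pos))
  hasDerivAt s hs := by
    refine ((h.hasDerivAt s hs).fun_sub ((Real.hasDerivAt_rpow_const (p := -m)
      (Or.inl (one_pos.trans hs.1).ne')).const_mul I)).congr_deriv ?_
    ring
  hasDerivAt_deriv s hs := by
    have hs0 : 0 < s := one_pos.trans hs.1
    refine ((h.hasDerivAt_deriv s hs).fun_add ((Real.hasDerivAt_rpow_const (p := -m - 1)
      (Or.inl hs0.ne')).const_mul (m * I))).congr_deriv ?_
    rw [Real.rpow_sub_one hs0.ne' (-m - 1)]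
    field_simp
    linear_combination (- I * s ^ (-m - 1)) * hm
  nonneg := h.nonneg

lemma mul_rpow_le (hm : m * (m + 1 - μ) = 0) (h : DampedODE μ 0 b Y Z r) (hY : Y 1 = I)
    (hZ : Z 1 = -(m * I)) : ∀ s ∈ Set.Icc 1 b, I * s ^ (-m) ≤ Y s := by
  intro s hs
  have hmono := (h.sub_mul_rpow hm I).monotoneOn (by simp [hZ]) (by simp)
  have := hmono (Set.left_mem_Icc.2 (hs.1.trans hs.2)) hs hs.1
  simpa [hY] using this

section ConstantForcing

variable {M s₁ s₂ : ℝ}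

lemma mul_sub_le_deriv (hμ : 0 ≤ μ) (h : DampedODE μ 0 b Y Z r) (hZ : 0 ≤ Z 1) (hM : 0 ≤ M)
    (h1 : 1 ≤ s₁) (h2 : s₂ ≤ b) (hr : ∀ s ∈ Set.Ioo s₁ s₂, M ≤ r s) :
    ∀ s ∈ Set.Icc s₁ s₂, (s₁ / s₂) ^ μ * M * (s - s₁) ≤ Z s := by
  intro s hs
  have hs₁ : 0 < s₁ := one_pos.trans_le h1
  have hs0 : 0 < s := hs₁.trans_le hs.1
  have hs₂ : 0 < s₂ := hs0.trans_le hs.2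
  have hsub : Set.Icc s₁ s₂ ⊆ Set.Icc 1 b := Set.Icc_subset_Icc h1 h2
  have hZ0 : ∀ s ∈ Set.Icc 1 b, 0 ≤ Z s := h.deriv_nonneg hZ (by simp)
  have hmono : MonotoneOn (fun s => s ^ μ * Z s - s₁ ^ μ * M * (s - s₁)) (Set.Icc s₁ s₂) := by
    refine monotoneOn_Icc_of_hasDerivAt_nonneg (f' := fun x => x ^ μ * r x - s₁ ^ μ * M)
      (((continuousOn_rpow_Icc μ hs₁).mul (h.cont_deriv.mono hsub)).sub (by fun_prop))
      (fun x hx => ?_) fun x hx => ?_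
    · refine ((h.hasDerivAt_integratingFactor ⟨h1.trans_lt hx.1, hx.2.trans_le h2⟩).fun_sub
        (((hasDerivAt_id x).sub_const s₁).const_mul (s₁ ^ μ * M))).congr_deriv ?_
      simp
    · exact sub_nonneg.2 (mul_le_mul (Real.rpow_le_rpow hs₁.le hx.1.le hμ) (hr x hx) hM
        (Real.rpow_nonneg (hs₁.trans hx.1).le _))
  have hle : s₁ ^ μ * Z s₁ ≤ s ^ μ * Z s - s₁ ^ μ * M * (s - s₁) := by
    simpa using hmono (Set.left_mem_Icc.2 (hs.1.trans hs.2)) hs hs.1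
  have hstart : 0 ≤ s₁ ^ μ * Z s₁ := mul_nonneg (Real.rpow_nonneg hs₁.le _)
    (hZ0 s₁ (hsub (Set.left_mem_Icc.2 (hs.1.trans hs.2))))
  have hend : s ^ μ * Z s ≤ s₂ ^ μ * Z s :=
    mul_le_mul_of_nonneg_right (Real.rpow_le_rpow hs0.le hs.2 hμ) (hZ0 s (hsub hs))
  rw [Real.div_rpow hs₁.le hs₂.le, div_mul_eq_mul_div, div_mul_eq_mul_div,
    div_le_iff₀ (Real.rpow_pos_of_pos hs₂ μ)]
  linarith

lemma mul_sq_le (hμ : 0 ≤ μ) (h : DampedODE μ 0 b Y Z r) (hY : 0 ≤ Y 1) (hZ : 0 ≤ Z 1)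
    (hM : 0 ≤ M) (h1 : 1 ≤ s₁) (h2 : s₂ ≤ b) (hr : ∀ s ∈ Set.Ioo s₁ s₂, M ≤ r s) :
    ∀ s ∈ Set.Icc s₁ s₂, (s₁ / s₂) ^ μ * M * (s - s₁) ^ 2 / 2 ≤ Y s := by
  intro s hs
  have hsub : Set.Icc s₁ s₂ ⊆ Set.Icc 1 b := Set.Icc_subset_Icc h1 h2
  have hs₁ : s₁ ∈ Set.Icc 1 b := hsub (Set.left_mem_Icc.2 (hs.1.trans hs.2))
  have hY₁ : 0 ≤ Y s₁ := hY.trans (h.monotoneOn hZ (by simp)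
    (Set.left_mem_Icc.2 (h1.trans hs₁.2)) hs₁ h1)
  have hmono : MonotoneOn (fun s => Y s - (s₁ / s₂) ^ μ * M * (s - s₁) ^ 2 / 2)
      (Set.Icc s₁ s₂) := by
    refine monotoneOn_Icc_of_hasDerivAt_nonneg
      (f' := fun x => Z x - (s₁ / s₂) ^ μ * M * (x - s₁))
      ((h.cont.mono hsub).sub (by fun_prop)) (fun x hx => ?_) fun x hx =>
      sub_nonneg.2 (h.mul_sub_le_deriv hμ hZ hM h1 h2 hr x (Set.Ioo_subset_Icc_self hx))
    refine ((h.hasDerivAt x ⟨h1.trans_lt hx.1, hx.2.trans_le h2⟩).fun_sub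
      (((((hasDerivAt_id x).sub_const s₁).fun_pow 2).const_mul
        ((s₁ / s₂) ^ μ * M)).div_const 2)).congr_deriv ?_
    simp only [id_eq, Nat.cast_ofNat, Nat.add_one_sub_one, pow_one, mul_one]
    ring
  have hle : Y s₁ ≤ Y s - (s₁ / s₂) ^ μ * M * (s - s₁) ^ 2 / 2 := by
    simpa using hmono (Set.left_mem_Icc.2 (hs.1.trans hs.2)) hs hs.1
  linarith

lemma mul_rpow_add_mul_sq_le (hμ : 0 ≤ μ) (hm : m * (m + 1 - μ) = 0) (h : DampedODE μ 0 b Y Z r)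
    (hY : Y 1 = I) (hZ : Z 1 = -(m * I)) (hM : 0 ≤ M) (h1 : 1 ≤ s₁) (h2 : s₂ ≤ b)
    (hr : ∀ s ∈ Set.Ioo s₁ s₂, M ≤ r s) :
    ∀ s ∈ Set.Icc s₁ s₂, I * s ^ (-m) + (s₁ / s₂) ^ μ * M * (s - s₁) ^ 2 / 2 ≤ Y s := by
  intro s hs
  have := (h.sub_mul_rpow hm I).mul_sq_le hμ (by simp [hY]) (by simp [hZ]) hM h1 h2 hr s hs
  linarith

end ConstantForcing

section PowerForcing

variable {p S β : ℝ}

lemma two_mul_le_of_le {B σ : ℝ} (hμ : 0 ≤ μ) (hp : 0 ≤ p) (hm : m * (m + 1 - μ) = 0)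
    (h : DampedODE μ 0 (2 * S) Y Z r) (hI : 0 ≤ I) (hY : Y 1 = I) (hZ : Z 1 = -(m * I))
    (hS : 1 ≤ S) (hβ : 0 ≤ β) (hr : ∀ s ∈ Set.Ioo S (2 * S), β * Y s ^ p ≤ r s) (hσ : S ≤ σ)
    (hB : 0 < B) (hBY : ∀ s ∈ Set.Icc σ (2 * S), B ≤ Y s) :
    ∀ s ∈ Set.Icc σ (2 * S), 4 * 2 ^ μ ≤ β * B ^ (p - 1) * (s - σ) ^ 2 → 2 * B ≤ Y s := by
  intro s hs hlarge
  have hs0 : 0 < s := one_pos.trans_le (hS.trans (hσ.trans hs.1))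
  have hforce : ∀ x ∈ Set.Ioo σ (2 * S), β * B ^ p ≤ r x := fun x hx =>
    le_trans (by gcongr; exact hBY x (Set.Ioo_subset_Icc_self hx)) (hr x ⟨hσ.trans_lt hx.1, hx.2⟩)
  have hdamp : (2 : ℝ)⁻¹ ^ μ ≤ (σ / (2 * S)) ^ μ := by
    refine Real.rpow_le_rpow (by norm_num) ?_ hμ
    rw [le_div_iff₀ (by positivity)]
    linarith
  calc 2 * B = (2 : ℝ)⁻¹ ^ μ * (4 * 2 ^ μ) * B / 2 := by
        rw [Real.inv_rpow two_pos.le]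
        field_simp
        norm_num
    _ ≤ (2 : ℝ)⁻¹ ^ μ * (β * B ^ (p - 1) * (s - σ) ^ 2) * B / 2 := by gcongr
    _ = 0 + (2 : ℝ)⁻¹ ^ μ * (β * B ^ p) * (s - σ) ^ 2 / 2 := by
        rw [Real.rpow_sub_one hB.ne']
        field_simp
        ring
    _ ≤ I * s ^ (-m) + (σ / (2 * S)) ^ μ * (β * B ^ p) * (s - σ) ^ 2 / 2 := by
        gcongr
        positivity
    _ ≤ Y s := h.mul_rpow_add_mul_sq_le hμ hm hY hZ (by positivity) (hS.trans hσ) le_rfl hforce s hs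

lemma two_pow_rpow_mul_sq (q : ℝ) (j : ℕ) :
    ((2 : ℝ) ^ j) ^ q * (((2 : ℝ) ^ (-(q / 2))) ^ j) ^ 2 = 1 := by
  have hsq : ((2 : ℝ) ^ (-(q / 2))) ^ 2 = (2 ^ q)⁻¹ := by
    rw [← Real.rpow_mul_natCast two_pos.le, Nat.cast_ofNat, neg_mul,
      div_mul_cancel₀ _ two_ne_zero, Real.rpow_neg two_pos.le]
  rw [← Real.rpow_pow_comm two_pos.le, pow_right_comm, hsq, ← mul_pow,
    mul_inv_cancel₀ (by positivity), one_pow]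

/-- The constant comes from doubling the lower bound on the shrinking intervals
`[S (2 - θ ^ j), 2 S]` with `θ = 2 ^ (-(p - 1) / 2)`: the gain `B ^ (p - 1)` of the nonlinear term
compensates exactly for the length of the intervals. -/
theorem exists_blowup_bound (hμ : 0 ≤ μ) (hp : 1 < p) : ∃ K : ℝ,
    ∀ (m I S β A : ℝ) (Y Z r : ℝ → ℝ), m * (m + 1 - μ) = 0 → DampedODE μ 0 (2 * S) Y Z r →
      0 ≤ I → Y 1 = I → Z 1 = -(m * I) → 1 ≤ S → 0 ≤ β → 0 < A →
      (∀ s ∈ Set.Ioo S (2 * S), β * Y s ^ p ≤ r s) →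
      (∀ s ∈ Set.Icc S (2 * S), A ≤ Y s) → β * A ^ (p - 1) * S ^ 2 ≤ K := by
  set θ : ℝ := (2 : ℝ) ^ (-((p - 1) / 2)) with hθ
  have hθ0 : 0 < θ := Real.rpow_pos_of_pos two_pos _
  have hθ1 : θ < 1 := Real.rpow_lt_one_of_one_lt_of_neg one_lt_two (by linarith)
  have : 0 < 1 - θ := sub_pos.2 hθ1
  refine ⟨4 * 2 ^ μ / (1 - θ) ^ 2, fun m I S β A Y Z r hm h hI hY hZ hS hβ hA hr hAY => ?_⟩
  by_contra! hlarge
  rw [div_lt_iff₀ (by positivity)] at hlarge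
  have : 0 < S := one_pos.trans_le hS
  have hdouble : ∀ j : ℕ, ∀ s ∈ Set.Icc (S * (2 - θ ^ j)) (2 * S), A * 2 ^ j ≤ Y s := by
    intro j
    induction j with
    | zero => exact fun s hs => by simpa using hAY s ⟨by linarith [hs.1], hs.2⟩
    | succ j ih =>
      intro s hs
      have hσ : S ≤ S * (2 - θ ^ j) := by nlinarith [pow_le_one₀ hθ0.le hθ1.le (n := j)]
      have hlen : S * (1 - θ) * θ ^ j ≤ s - S * (2 - θ ^ j) := by
        refine le_trans (le_of_eq ?_) (sub_le_sub_right hs.1 _)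
        ring
      have hgap : 0 ≤ S * (1 - θ) * θ ^ j := by positivity
      rw [pow_succ', mul_left_comm]
      refine h.two_mul_le_of_le hμ (by linarith) hm hI hY hZ hS hβ hr hσ (by positivity) ih s
        ⟨by linarith, hs.2⟩ ?_
      calc 4 * 2 ^ μ ≤ β * A ^ (p - 1) * S ^ 2 * (1 - θ) ^ 2 := hlarge.le
        _ = β * A ^ (p - 1) * S ^ 2 * (1 - θ) ^ 2 * (((2 : ℝ) ^ j) ^ (p - 1) * (θ ^ j) ^ 2) := by
          rw [hθ, two_pow_rpow_mul_sq, mul_one]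
        _ = β * (A * 2 ^ j) ^ (p - 1) * (S * (1 - θ) * θ ^ j) ^ 2 := by
          rw [Real.mul_rpow hA.le (by positivity)]
          ring
        _ ≤ β * (A * 2 ^ j) ^ (p - 1) * (s - S * (2 - θ ^ j)) ^ 2 := by gcongr
  obtain ⟨j, hj⟩ := pow_unbounded_of_one_lt (Y (2 * S) / A) one_lt_two
  have hle := hdouble j (2 * S) ⟨by nlinarith [pow_pos hθ0 j], le_rfl⟩
  rw [div_lt_iff₀' hA] at hj
  exact hle.not_gt hj

end PowerForcing

end DampedODE

/-! ### A radial eigenfunction of the Laplacian -/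

/-- The coefficients `1 / (4 ^ k k! (ν)_k)` of `besselSeries`. -/
def besselCoeff (ν : ℝ) (k : ℕ) : ℝ :=
  (4 ^ k * (k.factorial : ℝ) * (ascPochhammer ℝ k).eval ν)⁻¹

/-- The entire function `∑ q ^ k / (4 ^ k k! (ν)_k)`, a normalized modified Bessel function: up to
a constant factor it is `s ^ (1 - ν) I_{ν - 1}(s)` at `q = s ^ 2`. -/
def besselSeries (ν q : ℝ) : ℝ := ∑' k : ℕ, q ^ k * besselCoeff ν k

lemma ascPochhammer_eval_succ_left (ν : ℝ) (k : ℕ) :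
    (ascPochhammer ℝ (k + 1)).eval ν = ν * (ascPochhammer ℝ k).eval (ν + 1) := by
  simp [ascPochhammer_succ_left]

section BesselSeries

variable {ν : ℝ}

lemma pow_le_ascPochhammer_eval (hν : 0 < ν) (k : ℕ) : ν ^ k ≤ (ascPochhammer ℝ k).eval ν := by
  induction k with
  | zero => simp
  | succ k ih =>
    rw [ascPochhammer_succ_eval, pow_succ]
    gcongr
    · exact (ascPochhammer_pos k ν hν).le
    · exact le_add_of_nonneg_right k.cast_nonneg

lemma besselCoeff_pos (hν : 0 < ν) (k : ℕ) : 0 < besselCoeff ν k := by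
  have := ascPochhammer_pos k ν hν
  have := Nat.factorial_pos k
  unfold besselCoeff
  positivity

lemma besselCoeff_zero (ν : ℝ) : besselCoeff ν 0 = 1 := by simp [besselCoeff]

lemma succ_mul_besselCoeff_succ (ν : ℝ) (k : ℕ) :
    (k + 1) * besselCoeff ν (k + 1) = besselCoeff (ν + 1) k / (4 * ν) := by
  have : (k : ℝ) + 1 ≠ 0 := by positivity
  simp only [besselCoeff, ascPochhammer_eval_succ_left, Nat.factorial_succ, pow_succ, mul_inv,
    div_eq_mul_inv, Nat.cast_mul, Nat.cast_succ]
  field_simp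

lemma besselCoeff_succ (hν : 0 < ν) (k : ℕ) : besselCoeff ν (k + 1) =
    besselCoeff (ν + 1) (k + 1) + besselCoeff (ν + 2) k / (4 * ν * (ν + 1)) := by
  have := ascPochhammer_pos k (ν + 1) (by linarith)
  have hshift : (ascPochhammer ℝ k).eval (ν + 2) =
      (ascPochhammer ℝ k).eval (ν + 1) * (ν + 1 + k) / (ν + 1) := by
    rw [← ascPochhammer_succ_eval, ascPochhammer_eval_succ_left, add_assoc, one_add_one_eq_two]
    field_simp
  have : (k.factorial : ℝ) ≠ 0 := by positivity
  have : ν + 1 + k ≠ 0 := by positivity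
  simp only [besselCoeff, ascPochhammer_eval_succ_left, Nat.factorial_succ, pow_succ,
    show ν + 1 + 1 = ν + 2 by ring, hshift, Nat.cast_mul, Nat.cast_succ]
  field_simp
  ring

lemma summable_besselSeries (hν : 0 < ν) (q : ℝ) :
    Summable fun k : ℕ => q ^ k * besselCoeff ν k := by
  refine Summable.of_norm_bounded (Real.summable_pow_div_factorial (|q| / (4 * ν))) fun k => ?_
  rw [norm_mul, norm_pow, Real.norm_eq_abs, Real.norm_eq_abs, abs_of_pos (besselCoeff_pos hν k),
    div_pow, mul_pow, besselCoeff]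
  calc |q| ^ k * (4 ^ k * (k.factorial : ℝ) * (ascPochhammer ℝ k).eval ν)⁻¹
      ≤ |q| ^ k * (4 ^ k * (k.factorial : ℝ) * ν ^ k)⁻¹ := by
        gcongr
        exact pow_le_ascPochhammer_eval hν k
    _ = |q| ^ k / (4 ^ k * ν ^ k) / k.factorial := by field_simp

lemma besselSeries_eq_one_add (hν : 0 < ν) (q : ℝ) :
    besselSeries ν q = 1 + ∑' k : ℕ, q ^ (k + 1) * besselCoeff ν (k + 1) := by
  rw [besselSeries, (summable_besselSeries hν q).tsum_eq_zero_add, pow_zero, besselCoeff_zero,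
    one_mul]

lemma hasDerivAt_besselSeries (hν : 0 < ν) (q : ℝ) :
    HasDerivAt (besselSeries ν) (besselSeries (ν + 1) q / (4 * ν)) q := by
  have hν1 : 0 < ν + 1 := by linarith
  have hsum : Summable fun k : ℕ => (|q| + 1) ^ k * besselCoeff (ν + 1) k / (4 * ν) :=
    (summable_besselSeries hν1 _).div_const _
  have hterm : ∀ (k : ℕ) (y : ℝ), HasDerivAt (fun y => y ^ (k + 1) * besselCoeff ν (k + 1))
      (y ^ k * besselCoeff (ν + 1) k / (4 * ν)) y := fun k y => by
    refine ((hasDerivAt_pow (k + 1) y).mul_const _).congr_deriv ?_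
    rw [mul_div_assoc, ← succ_mul_besselCoeff_succ]
    push_cast
    ring
  have hbound : ∀ (k : ℕ), ∀ y ∈ Metric.ball (0 : ℝ) (|q| + 1),
      ‖y ^ k * besselCoeff (ν + 1) k / (4 * ν)‖ ≤
        (|q| + 1) ^ k * besselCoeff (ν + 1) k / (4 * ν) := fun k y hy => by
    have := besselCoeff_pos hν1 k
    rw [norm_div, norm_mul, norm_pow, Real.norm_of_nonneg this.le,
      Real.norm_of_nonneg (by positivity : 0 ≤ 4 * ν)]
    gcongr
    exact (mem_ball_zero_iff.1 hy).le
  have hderiv := hasDerivAt_tsum_of_isPreconnected hsum Metric.isOpen_ball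
    (convex_ball (0 : ℝ) (|q| + 1)).isPreconnected (fun k y _ => hterm k y) hbound
    (Metric.mem_ball_self (by positivity)) (by simp) (y := q) (by simp)
  rw [funext (besselSeries_eq_one_add hν)]
  refine (hderiv.const_add 1).congr_deriv ?_
  rw [tsum_div_const, besselSeries]

lemma contDiff_besselSeries (hν : 0 < ν) : ContDiff ℝ ∞ (besselSeries ν) := by
  rw [contDiff_infty]
  intro N
  induction N generalizing ν with
  | zero =>
    exact contDiff_zero.2 (continuous_iff_continuousAt.2 fun q =>
      (hasDerivAt_besselSeries hν q).continuousAt)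
  | succ N ih =>
    push_cast
    rw [contDiff_succ_iff_deriv]
    refine ⟨fun q => (hasDerivAt_besselSeries hν q).differentiableAt, by simp, ?_⟩
    rw [funext fun q => (hasDerivAt_besselSeries hν q).deriv]
    exact (ih (by linarith)).div_const _

lemma besselSeries_eq_add (hν : 0 < ν) (q : ℝ) : besselSeries ν q =
    besselSeries (ν + 1) q + q * (besselSeries (ν + 2) q / (4 * ν * (ν + 1))) := by
  have hν1 : 0 < ν + 1 := by linarith
  have hsum₁ := (summable_nat_add_iff 1).2 (summable_besselSeries hν1 q)
  have hsum₂ := ((summable_besselSeries (by linarith : 0 < ν + 2) q).div_const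
    (4 * ν * (ν + 1))).mul_left q
  rw [besselSeries_eq_one_add hν, besselSeries_eq_one_add hν1, besselSeries, ← tsum_div_const,
    ← tsum_mul_left, add_assoc, ← hsum₁.tsum_add hsum₂]
  congr 1
  refine tsum_congr fun k => ?_
  rw [besselCoeff_succ hν]
  ring

lemma one_le_besselSeries (hν : 0 < ν) {q : ℝ} (hq : 0 ≤ q) : 1 ≤ besselSeries ν q := by
  rw [besselSeries_eq_one_add hν, le_add_iff_nonneg_right]
  exact tsum_nonneg fun k => mul_nonneg (pow_nonneg hq _) (besselCoeff_pos hν _).le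

lemma hasDerivAt_besselSeries_sq (hν : 0 < ν) (s : ℝ) :
    HasDerivAt (fun s => besselSeries ν (s ^ 2)) (besselSeries (ν + 1) (s ^ 2) * (s / (2 * ν)))
      s := by
  refine ((hasDerivAt_besselSeries hν (s ^ 2)).comp s (hasDerivAt_pow 2 s)).congr_deriv ?_
  simp only [Nat.cast_ofNat, Nat.add_one_sub_one, pow_one]
  field_simp
  ring

lemma exists_besselSeries_sq_le (hν : 1 ≤ 2 * ν) : ∃ C : ℝ, 0 < C ∧ ∀ s : ℝ, 0 ≤ s →
    besselSeries ν (s ^ 2) ≤ C * ((1 + s) ^ (-((2 * ν - 1) / 2)) * Real.exp s) := by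
  have hν0 : 0 < ν := by linarith
  have hν1 : 0 < ν + 1 := by linarith
  refine exists_growth_upper (Z := fun s => besselSeries (ν + 1) (s ^ 2) * (s / (2 * ν)))
    (sub_nonneg.2 hν)
    (((contDiff_besselSeries hν0).continuous.comp (continuous_pow 2)).continuousOn)
    (fun s _ => hasDerivAt_besselSeries_sq hν0 s) (fun s hs => ?_)
    (fun s _ => (zero_le_one.trans (one_le_besselSeries hν0 (sq_nonneg s))))
    (fun s hs => mul_nonneg (zero_le_one.trans (one_le_besselSeries hν1 (sq_nonneg s)))
      (by positivity))
  refine ((hasDerivAt_besselSeries_sq hν1 s).fun_mul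
    ((hasDerivAt_id s).div_const (2 * ν))).congr_deriv ?_
  rw [besselSeries_eq_add hν0, show ν + 1 + 1 = ν + 2 by ring, id_eq]
  field_simp
  ring

end BesselSeries

section Laplacian

variable {E : Type*} [NormedAddCommGroup E] [InnerProductSpace ℝ E] [FiniteDimensional ℝ E]

lemma laplacian_eq_sum_fderiv {ι : Type*} [Fintype ι] (e : OrthonormalBasis ι ℝ E) {ψ : E → ℝ}
    (hψ : ContDiff ℝ 2 ψ) (x : E) :
    Δ ψ x = ∑ i, fderiv ℝ (fun y => fderiv ℝ ψ y (e i)) x (e i) := by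
  have hdiff : DifferentiableAt ℝ (fderiv ℝ ψ) x :=
    (hψ.fderiv_right (m := 1) le_rfl).differentiable one_ne_zero x
  rw [InnerProductSpace.laplacian_eq_iteratedFDeriv_orthonormalBasis ψ e]
  refine Finset.sum_congr rfl fun i _ => ?_
  rw [iteratedFDeriv_two_apply, fderiv_clm_apply hdiff (differentiableAt_const _)]
  simp

lemma laplacian_comp_norm_sq {F F' F'' : ℝ → ℝ} (hF : ContDiff ℝ 2 F)
    (hF' : ∀ q, HasDerivAt F (F' q) q) (hF'' : ∀ q, HasDerivAt F' (F'' q) q) (x : E) :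
    Δ (fun y : E => F (‖y‖ ^ 2)) x =
      4 * ‖x‖ ^ 2 * F'' (‖x‖ ^ 2) + 2 * Module.finrank ℝ E * F' (‖x‖ ^ 2) := by
  have hsq : ∀ y : E, HasFDerivAt (fun y : E => ‖y‖ ^ 2) (2 • innerSL ℝ y) y := fun y =>
    (hasStrictFDerivAt_norm_sq y).hasFDerivAt
  have hfst : ∀ e : E, (fun y => fderiv ℝ (fun y : E => F (‖y‖ ^ 2)) y e) =
      fun y => F' (‖y‖ ^ 2) * (2 * inner ℝ e y) := fun e => by
    funext y
    have hcomp : HasFDerivAt (fun y : E => F (‖y‖ ^ 2)) _ y := (hF' _).comp_hasFDerivAt y (hsq y)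
    rw [hcomp.fderiv]
    simp [real_inner_comm]
  have hsnd : ∀ e : E, ‖e‖ = 1 →
      fderiv ℝ (fun y => fderiv ℝ (fun y : E => F (‖y‖ ^ 2)) y e) x e =
        4 * F'' (‖x‖ ^ 2) * inner ℝ e x ^ 2 + 2 * F' (‖x‖ ^ 2) := fun e he => by
    have hinner : HasFDerivAt (fun y : E => 2 * inner ℝ e y) ((2 : ℝ) • innerSL ℝ e) x :=
      (innerSL ℝ e).hasFDerivAt.const_mul 2
    have hcomp : HasFDerivAt (fun y : E => F' (‖y‖ ^ 2)) _ x := (hF'' _).comp_hasFDerivAt x (hsq x)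
    rw [hfst, (hcomp.fun_mul hinner).fderiv]
    simp only [add_apply, smul_apply, innerSL_apply_apply,
      real_inner_self_eq_norm_sq, he, real_inner_comm e x, smul_eq_mul, nsmul_eq_mul]
    push_cast
    ring
  rw [laplacian_eq_sum_fderiv (stdOrthonormalBasis ℝ E)
    (hF.fun_comp (contDiff_norm_sq ℝ))]
  simp only [hsnd _ ((stdOrthonormalBasis ℝ E).orthonormal.1 _)]
  rw [Finset.sum_add_distrib, ← Finset.mul_sum, OrthonormalBasis.sum_sq_inner_right]
  simp
  ring

end Laplacian

/-- A positive radial solution of `Δ φ = φ` on `ℝⁿ`. -/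
def radialEigen {n : ℕ} (x : Space n) : ℝ := besselSeries (n / 2) (‖x‖ ^ 2)

section RadialEigen

variable {n : ℕ}

lemma contDiff_radialEigen (hn : 1 ≤ n) : ContDiff ℝ ∞ (radialEigen (n := n)) :=
  (contDiff_besselSeries (by positivity)).comp (contDiff_norm_sq ℝ)

lemma one_le_radialEigen (hn : 1 ≤ n) (x : Space n) : 1 ≤ radialEigen x :=
  one_le_besselSeries (by positivity) (by positivity)

lemma laplacian_radialEigen (hn : 1 ≤ n) (x : Space n) : Δ radialEigen x = radialEigen x := by
  obtain ⟨ν, hν⟩ : ∃ ν : ℝ, ν = n / 2 := ⟨_, rfl⟩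
  have hν0 : 0 < ν := by rw [hν]; positivity
  have hdef : radialEigen = fun y : Space n => besselSeries ν (‖y‖ ^ 2) := by rw [hν]; rfl
  simp only [hdef]
  rw [laplacian_comp_norm_sq ((contDiff_besselSeries hν0).of_le (by norm_cast))
    (hasDerivAt_besselSeries hν0)
    (fun q => (hasDerivAt_besselSeries (by linarith : 0 < ν + 1) q).div_const (4 * ν)),
    finrank_euclideanSpace_fin, besselSeries_eq_add hν0, show ν + 1 + 1 = ν + 2 by ring,
    show (n : ℝ) = 2 * ν by rw [hν]; ring]
  field_simp
  ring

end RadialEigen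

section Integral

lemma exists_rpow_le_exp {a b : ℝ} (ha : 0 ≤ a) (hb : 0 < b) : ∃ C : ℝ, 0 < C ∧
    ∀ w : ℝ, 0 ≤ w → (1 + w) ^ a ≤ C * Real.exp (b * w) := by
  have ha1 : 0 < a + 1 := by linarith
  set c : ℝ := b / (a + 1)
  have hc : 0 < c := by positivity
  refine ⟨c⁻¹ ^ (a + 1) * Real.exp b, by positivity, fun w hw => ?_⟩
  have hlin : 1 + w ≤ c⁻¹ * Real.exp (c * (1 + w)) := by
    rw [le_inv_mul_iff₀ hc]
    linarith [Real.add_one_le_exp (c * (1 + w))]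
  calc (1 + w) ^ a ≤ (1 + w) ^ (a + 1) :=
        Real.rpow_le_rpow_of_exponent_le (by linarith) (by linarith)
    _ ≤ (c⁻¹ * Real.exp (c * (1 + w))) ^ (a + 1) := Real.rpow_le_rpow (by linarith) hlin ha1.le
    _ = c⁻¹ ^ (a + 1) * Real.exp b * Real.exp (b * w) := by
      rw [Real.mul_rpow (by positivity) (Real.exp_pos _).le, ← Real.exp_mul,
        mul_assoc (c⁻¹ ^ (a + 1)), ← Real.exp_add]
      congr 2
      simp only [c]
      field_simp

lemma one_add_rpow_le_rpow_mul (Q : ℝ) {X y : ℝ} (hy : 0 ≤ y) (hyX : y ≤ X) :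
    (1 + y) ^ Q ≤ (1 + X) ^ Q * (1 + (X - y)) ^ |Q| := by
  have hy1 : 0 < 1 + y := by linarith
  have hX1 : 0 < 1 + X := by linarith
  have hd1 : 1 ≤ 1 + (X - y) := by linarith
  rcases le_total 0 Q with hQ | hQ
  · exact (Real.rpow_le_rpow hy1.le (by linarith) hQ).trans
      (le_mul_of_one_le_right (Real.rpow_nonneg hX1.le _) (Real.one_le_rpow hd1 (abs_nonneg Q)))
  · rw [abs_of_nonpos hQ, ← inv_inv ((1 + X) ^ Q), ← Real.rpow_neg hX1.le, inv_mul_eq_div,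
      le_div_iff₀ (by positivity), ← inv_inv ((1 + y) ^ Q), ← Real.rpow_neg hy1.le,
      inv_mul_eq_div, div_le_iff₀ (by positivity), ← Real.mul_rpow (by linarith) hy1.le]
    exact Real.rpow_le_rpow hX1.le (by nlinarith) (neg_nonneg.2 hQ)

lemma exists_integral_rpow_mul_exp_le (Q : ℝ) {q : ℝ} (hq : 0 < q) : ∃ C : ℝ, 0 < C ∧
    ∀ X : ℝ, 0 ≤ X →
      ∫ y in (0 : ℝ)..X, (1 + y) ^ Q * Real.exp (q * y) ≤ C * ((1 + X) ^ Q * Real.exp (q * X)) := by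
  obtain ⟨C, hC, hpoly⟩ := exists_rpow_le_exp (abs_nonneg Q) (half_pos hq)
  refine ⟨C * (2 / q), by positivity, fun X hX => ?_⟩
  have : 0 < 1 + X := by linarith
  have hcont : ContinuousOn (fun y : ℝ => (1 + y) ^ Q * Real.exp (q * y)) (Set.uIcc 0 X) := by
    refine ContinuousOn.mul (ContinuousOn.rpow_const (by fun_prop) fun y hy => Or.inl ?_)
      (by fun_prop)
    rw [Set.uIcc_of_le hX] at hy
    linarith [hy.1]
  have hexp : ∫ y in (0 : ℝ)..X, Real.exp (q / 2 * y) ≤ 2 / q * Real.exp (q / 2 * X) := by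
    rw [intervalIntegral.integral_comp_mul_left _ (by positivity : q / 2 ≠ 0), integral_exp,
      smul_eq_mul, mul_zero, Real.exp_zero, inv_div]
    gcongr
    linarith
  have hpoint : ∀ y ∈ Set.Icc 0 X, (1 + y) ^ Q * Real.exp (q * y) ≤
      C * (1 + X) ^ Q * Real.exp (q / 2 * X) * Real.exp (q / 2 * y) := fun y hy =>
    calc (1 + y) ^ Q * Real.exp (q * y)
        ≤ (1 + X) ^ Q * (C * Real.exp (q / 2 * (X - y))) * Real.exp (q * y) := by
          gcongr
          refine (one_add_rpow_le_rpow_mul Q hy.1 hy.2).trans ?_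
          gcongr
          exact hpoly _ (by linarith [hy.2])
      _ = C * (1 + X) ^ Q * (Real.exp (q / 2 * (X - y)) * Real.exp (q * y)) := by ring
      _ = C * (1 + X) ^ Q * Real.exp (q / 2 * X) * Real.exp (q / 2 * y) := by
          rw [← Real.exp_add, mul_assoc _ (Real.exp _), ← Real.exp_add]
          ring_nf
  calc ∫ y in (0 : ℝ)..X, (1 + y) ^ Q * Real.exp (q * y)
      ≤ ∫ y in (0 : ℝ)..X, C * (1 + X) ^ Q * Real.exp (q / 2 * X) * Real.exp (q / 2 * y) :=
        intervalIntegral.integral_mono_on hX hcont.intervalIntegrable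
          ((by fun_prop : Continuous _).intervalIntegrable _ _) hpoint
    _ ≤ C * (1 + X) ^ Q * Real.exp (q / 2 * X) * (2 / q * Real.exp (q / 2 * X)) := by
        rw [intervalIntegral.integral_const_mul]
        gcongr
    _ = C * (2 / q) * ((1 + X) ^ Q * Real.exp (q * X)) := by
        rw [show q * X = q / 2 * X + q / 2 * X by ring, Real.exp_add]
        ring

lemma setIntegral_closedBall_fun_norm {E : Type*} [NormedAddCommGroup E] [NormedSpace ℝ E]
    [Nontrivial E] [FiniteDimensional ℝ E] [MeasurableSpace E] [BorelSpace E] (ν : Measure E)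
    [ν.IsAddHaarMeasure] (F : ℝ → ℝ) {X : ℝ} (hX : 0 ≤ X) :
    ∫ x in Metric.closedBall (0 : E) X, F ‖x‖ ∂ν =
      Module.finrank ℝ E * ν.real (Metric.ball 0 1) *
        ∫ y in (0 : ℝ)..X, y ^ (Module.finrank ℝ E - 1) * F y := by
  have hpolar := integral_fun_norm_addHaar ν ((Set.Iic X).indicator F)
  rw [nsmul_eq_mul, smul_eq_mul, ← mul_assoc] at hpolar
  rw [← integral_indicator measurableSet_closedBall, intervalIntegral.integral_of_le hX,
    ← Set.Ioi_inter_Iic, ← setIntegral_indicator measurableSet_Iic]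
  convert hpolar using 1
  · congr 1
    funext x
    simp [Set.indicator]
  · congr 2
    funext y
    simp [Set.indicator]

lemma exists_pow_mul_besselSeries_rpow_le {n : ℕ} (hn : 1 ≤ n) {q : ℝ} (hq : 0 < q) :
    ∃ C : ℝ, 0 < C ∧ ∀ y : ℝ, 0 ≤ y → y ^ (n - 1) * besselSeries (n / 2) (y ^ 2) ^ q ≤
      C * ((1 + y) ^ (((n : ℝ) - 1) * (1 - q / 2)) * Real.exp (q * y)) := by
  have hn1 : (1 : ℝ) ≤ n := by exact_mod_cast hn
  obtain ⟨C, hC, hbound⟩ := exists_besselSeries_sq_le (ν := n / 2) (by linarith)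
  refine ⟨C ^ q, by positivity, fun y hy => ?_⟩
  have hB0 : 0 ≤ besselSeries (n / 2) (y ^ 2) :=
    zero_le_one.trans (one_le_besselSeries (by positivity) (sq_nonneg y))
  have hy1 : 0 < 1 + y := by linarith
  calc y ^ (n - 1) * besselSeries (n / 2) (y ^ 2) ^ q
      ≤ (1 + y) ^ (n - 1) *
          (C * ((1 + y) ^ (-((2 * ((n : ℝ) / 2) - 1) / 2)) * Real.exp y)) ^ q := by
        gcongr
        · linarith
        · exact hbound y hy
    _ = C ^ q * ((1 + y) ^ ((n : ℝ) - 1) * (1 + y) ^ (-((2 * ((n : ℝ) / 2) - 1) / 2) * q)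
          * Real.exp (q * y)) := by
        rw [Real.mul_rpow hC.le (by positivity), Real.mul_rpow (by positivity) (Real.exp_pos _).le,
          ← Real.rpow_mul hy1.le, ← Real.exp_mul, mul_comm y q, ← Real.rpow_natCast,
          Nat.cast_sub hn, Nat.cast_one]
        ring
    _ = C ^ q * ((1 + y) ^ (((n : ℝ) - 1) * (1 - q / 2)) * Real.exp (q * y)) := by
        rw [← Real.rpow_add hy1]
        ring_nf

theorem exists_integral_radialEigen_rpow_le {n : ℕ} (hn : 1 ≤ n) {q : ℝ} (hq : 0 < q) :
    ∃ C : ℝ, 0 < C ∧ ∀ X : ℝ, 0 ≤ X →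
      ∫ x in Metric.closedBall (0 : Space n) X, radialEigen x ^ q ≤
        C * ((1 + X) ^ (((n : ℝ) - 1) * (1 - q / 2)) * Real.exp (q * X)) := by
  have : Nonempty (Fin n) := ⟨⟨0, hn⟩⟩
  obtain ⟨C₁, hC₁, hpoint⟩ := exists_pow_mul_besselSeries_rpow_le hn hq
  obtain ⟨C₂, hC₂, hint⟩ :=
    exists_integral_rpow_mul_exp_le (((n : ℝ) - 1) * (1 - q / 2)) hq
  set V : ℝ := n * (volume : Measure (Space n)).real (Metric.ball 0 1)
  have hV : 0 < V := mul_pos (by positivity)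
    (ENNReal.toReal_pos (Metric.measure_ball_pos _ _ one_pos).ne' measure_ball_lt_top.ne)
  refine ⟨V * (C₁ * C₂), by positivity, fun X hX => ?_⟩
  have hcont : Continuous fun y : ℝ => y ^ (n - 1) * besselSeries (n / 2) (y ^ 2) ^ q := by
    have hν : (0 : ℝ) < n / 2 := by positivity
    refine (continuous_pow _).mul (((contDiff_besselSeries hν).continuous.comp
      (continuous_pow 2)).rpow_const fun y => Or.inl ?_)
    exact (one_pos.trans_le (one_le_besselSeries hν (sq_nonneg y))).ne'
  have hcont' : ContinuousOn (fun y : ℝ => C₁ * ((1 + y) ^ (((n : ℝ) - 1) * (1 - q / 2)) *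
      Real.exp (q * y))) (Set.uIcc 0 X) := by
    refine continuousOn_const.mul (ContinuousOn.mul (ContinuousOn.rpow_const (by fun_prop)
      fun y hy => Or.inl ?_) (by fun_prop))
    rw [Set.uIcc_of_le hX] at hy
    linarith [hy.1]
  calc ∫ x in Metric.closedBall (0 : Space n) X, radialEigen x ^ q
      = V * ∫ y in (0 : ℝ)..X, y ^ (n - 1) * besselSeries (n / 2) (y ^ 2) ^ q := by
        simpa only [V, radialEigen, finrank_euclideanSpace_fin] using
          setIntegral_closedBall_fun_norm
          (volume : Measure (Space n)) (fun s => besselSeries (n / 2) (s ^ 2) ^ q) hX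
    _ ≤ V * ∫ y in (0 : ℝ)..X,
          C₁ * ((1 + y) ^ (((n : ℝ) - 1) * (1 - q / 2)) * Real.exp (q * y)) := by
        gcongr
        exact intervalIntegral.integral_mono_on hX (hcont.intervalIntegrable _ _)
          hcont'.intervalIntegrable fun y hy => hpoint y hy.1
    _ ≤ V * (C₁ * (C₂ * ((1 + X) ^ (((n : ℝ) - 1) * (1 - q / 2)) * Real.exp (q * X)))) := by
        rw [intervalIntegral.integral_const_mul]
        gcongr
        exact hint X hX
    _ = V * (C₁ * C₂) * ((1 + X) ^ (((n : ℝ) - 1) * (1 - q / 2)) * Real.exp (q * X)) := by ring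

end Integral

/-! ### Continuity of weighted `L ^ p` integrals -/

section Lp

variable {α ι : Type*} [MeasurableSpace α] {ν : Measure α} {l : Filter ι}

lemma tendsto_eLpNorm_of_tendsto_sub {E : Type*} [NormedAddCommGroup E] {q : ℝ≥0∞} (hq : 1 ≤ q)
    {w : ι → α → E} {w₀ : α → E} (hw₀ : MemLp w₀ q ν) (hw : ∀ᶠ i in l, MemLp (w i) q ν)
    (hlim : Tendsto (fun i => eLpNorm (w i - w₀) q ν) l (𝓝 0)) :
    Tendsto (fun i => eLpNorm (w i) q ν) l (𝓝 (eLpNorm w₀ q ν)) := by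
  have hupper : Tendsto (fun i => eLpNorm w₀ q ν + eLpNorm (w i - w₀) q ν) l
      (𝓝 (eLpNorm w₀ q ν)) := by
    simpa using tendsto_const_nhds.add hlim
  have hlower : Tendsto (fun i => eLpNorm w₀ q ν - eLpNorm (w i - w₀) q ν) l
      (𝓝 (eLpNorm w₀ q ν)) := by
    simpa using ENNReal.Tendsto.sub tendsto_const_nhds hlim (Or.inl hw₀.eLpNorm_ne_top)
  refine tendsto_of_tendsto_of_tendsto_of_le_of_le' hlower hupper ?_ ?_
  · filter_upwards [hw] with i hi
    rw [tsub_le_iff_right]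
    simpa only [sub_sub_cancel] using eLpNorm_sub_le hi.1 (hi.1.sub hw₀.1) hq
  · filter_upwards [hw] with i hi
    simpa only [add_sub_cancel] using eLpNorm_add_le hw₀.1 (hi.1.sub hw₀.1) hq

lemma tendsto_integral_abs_rpow {p : ℝ} (hp : 1 ≤ p) {w : ι → α → ℝ} {w₀ : α → ℝ}
    (hw₀ : MemLp w₀ (ENNReal.ofReal p) ν) (hw : ∀ᶠ i in l, MemLp (w i) (ENNReal.ofReal p) ν)
    (hlim : Tendsto (fun i => eLpNorm (w i - w₀) (ENNReal.ofReal p) ν) l (𝓝 0)) :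
    Tendsto (fun i => ∫ x, |w i x| ^ p ∂ν) l (𝓝 (∫ x, |w₀ x| ^ p ∂ν)) := by
  have hp0 : 0 < p := one_pos.trans_le hp
  have integral_eq : ∀ f : α → ℝ, MemLp f (ENNReal.ofReal p) ν →
      (eLpNorm f (ENNReal.ofReal p) ν).toReal ^ p = ∫ x, |f x| ^ p ∂ν := by
    intro f hf
    have hnonneg : 0 ≤ ∫ x, |f x| ^ p ∂ν := by positivity
    rw [hf.eLpNorm_eq_integral_rpow_norm (by positivity) ENNReal.ofReal_ne_top,
      ENNReal.toReal_ofReal hp0.le]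
    simp only [Real.norm_eq_abs]
    rw [ENNReal.toReal_ofReal (by positivity), Real.rpow_inv_rpow hnonneg hp0.ne']
  have hnorm := (ENNReal.tendsto_toReal hw₀.eLpNorm_ne_top).comp
    (tendsto_eLpNorm_of_tendsto_sub (ENNReal.one_le_ofReal.2 hp) hw₀ hw hlim)
  rw [← integral_eq w₀ hw₀]
  refine (hnorm.rpow_const (Or.inr hp0.le)).congr' ?_
  filter_upwards [hw] with i hi using integral_eq (w i) hi

lemma tendsto_integral_abs_rpow_mul {p : ℝ} (hp : 1 ≤ p) {w : ι → α → ℝ} {w₀ Φ : α → ℝ}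
    {c : ℝ} (hΦm : Measurable Φ) (hΦ : ∀ x, 0 ≤ Φ x) (hΦc : ∀ x, Φ x ≤ c)
    (hw₀ : MemLp w₀ (ENNReal.ofReal p) ν) (hw : ∀ᶠ i in l, MemLp (w i) (ENNReal.ofReal p) ν)
    (hlim : Tendsto (fun i => eLpNorm (w i - w₀) (ENNReal.ofReal p) ν) l (𝓝 0)) :
    Tendsto (fun i => ∫ x, |w i x| ^ p * Φ x ∂ν) l (𝓝 (∫ x, |w₀ x| ^ p * Φ x ∂ν)) := by
  set ν' : Measure α := ν.withDensity fun x => ENNReal.ofReal (Φ x)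
  have hν' : ν' ≤ ENNReal.ofReal c • ν := by
    rw [← withDensity_const]
    exact withDensity_mono (ae_of_all _ fun x => ENNReal.ofReal_le_ofReal (hΦc x))
  have integral_eq : ∀ f : α → ℝ, ∫ x, |f x| ^ p * Φ x ∂ν = ∫ x, |f x| ^ p ∂ν' := fun f => by
    rw [integral_withDensity_eq_integral_toReal_smul hΦm.ennreal_ofReal
      (ae_of_all _ fun _ => ENNReal.ofReal_lt_top)]
    simp only [ENNReal.toReal_ofReal (hΦ _), smul_eq_mul, mul_comm]
  simp only [integral_eq]
  refine tendsto_integral_abs_rpow hp (hw₀.of_measure_le_smul ENNReal.ofReal_ne_top hν')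
    (hw.mono fun i hi => hi.of_measure_le_smul ENNReal.ofReal_ne_top hν') ?_
  refine tendsto_of_tendsto_of_tendsto_of_le_of_le tendsto_const_nhds ?_ (fun _ => zero_le)
    fun i => eLpNorm_le_of_measure_le_smul hν'
  simpa using ENNReal.Tendsto.const_mul hlim
    (Or.inr (ENNReal.rpow_ne_top_of_nonneg (by positivity) ENNReal.ofReal_ne_top))

end Lp

/-! ### Averages of energy solutions -/

section IntegrationByParts

variable {n : ℕ} {w : Space n → ℝ} {G : Space n → Space n} {Φ : Space n → ℝ}

lemma HasWeakGradient.integral_mul_fderiv_basisFun (h : HasWeakGradient w G)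
    (hw : LocallyIntegrable w) (hG : LocallyIntegrable G) (hΦ : ContDiff ℝ ∞ Φ)
    (hc : HasCompactSupport Φ) (i : Fin n) :
    ∫ x, w x * fderiv ℝ Φ x (EuclideanSpace.basisFun (Fin n) ℝ i) = -∫ x, Φ x * G x i := by
  have hgrad : Continuous (gradient Φ) :=
    (InnerProductSpace.toDual ℝ (Space n)).symm.continuous.comp (hΦ.continuous_fderiv (by simp))
  have hwΦ : Integrable fun x => w x • gradient Φ x :=
    hw.integrable_smul_right_of_hasCompactSupport hgrad
      ((hc.fderiv (𝕜 := ℝ)).comp_left (map_zero _))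
  have hΦG : Integrable fun x => Φ x • G x :=
    hG.integrable_smul_left_of_hasCompactSupport hΦ.continuous hc
  have hcoord := congrArg (EuclideanSpace.proj i : Space n →L[ℝ] ℝ) (h Φ hΦ hc)
  rw [map_neg, ← ContinuousLinearMap.integral_comp_comm _ hwΦ,
    ← ContinuousLinearMap.integral_comp_comm _ hΦG] at hcoord
  have hfderiv : ∀ x, fderiv ℝ Φ x (EuclideanSpace.basisFun (Fin n) ℝ i) = gradient Φ x i :=
    fun x => by simp [← inner_gradient_left, EuclideanSpace.inner_single_right]
  simp_rw [hfderiv]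
  simpa using hcoord

lemma HasWeakGradient.integral_inner_gradient (h : HasWeakGradient w G)
    (hw : LocallyIntegrable w) (hG : LocallyIntegrable G) (hΦ : ContDiff ℝ ∞ Φ)
    (hc : HasCompactSupport Φ) :
    ∫ x, inner ℝ (G x) (gradient Φ x) = -∫ x, w x * Δ Φ x := by
  set e := EuclideanSpace.basisFun (Fin n) ℝ
  set D : Fin n → Space n → ℝ := fun i x => fderiv ℝ Φ x (e i)
  have hD : ∀ i, ContDiff ℝ ∞ (D i) := fun i =>
    (hΦ.fderiv_right (m := ∞) (by simp)).clm_apply contDiff_const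
  have hDc : ∀ i, HasCompactSupport (D i) := fun i => hc.fderiv_apply ℝ (e i)
  have hinner : ∀ x, inner ℝ (G x) (gradient Φ x) = ∑ i, D i x * G x i := fun x => by
    rw [real_inner_comm, inner_gradient_left]
    conv_lhs => rw [← e.sum_repr (G x)]
    simp [D, e, mul_comm]
  have hlaplacian : ∀ x, w x * Δ Φ x = ∑ i, w x * fderiv ℝ (D i) x (e i) := fun x => by
    rw [laplacian_eq_sum_fderiv e (hΦ.of_le (by norm_cast)), Finset.mul_sum]
  have hDG : ∀ i, Integrable fun x => D i x * G x i := fun i => by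
    simpa using (EuclideanSpace.proj i : Space n →L[ℝ] ℝ).integrable_comp
      (hG.integrable_smul_left_of_hasCompactSupport (hD i).continuous (hDc i))
  have hwD : ∀ i, Integrable fun x => w x * fderiv ℝ (D i) x (e i) := fun i =>
    hw.integrable_smul_right_of_hasCompactSupport
      (((hD i).continuous_fderiv (by simp)).clm_apply continuous_const)
      ((hDc i).fderiv_apply ℝ (e i))
  simp_rw [hinner, hlaplacian]
  rw [integral_finsetSum _ fun i _ => hDG i, integral_finsetSum _ fun i _ => hwD i,
    ← Finset.sum_neg_distrib]
  exact Finset.sum_congr rfl fun i _ => by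
    rw [h.integral_mul_fderiv_basisFun hw hG (hD i) (hDc i), neg_neg]

lemma memLp_laplacian (hΦ : ContDiff ℝ ∞ Φ) (hc : HasCompactSupport Φ) : MemLp (Δ Φ) 2 := by
  rw [funext (laplacian_eq_sum_fderiv (EuclideanSpace.basisFun (Fin n) ℝ)
    (hΦ.of_le (by norm_cast)))]
  refine memLp_finsetSum _ fun i _ => Continuous.memLp_of_hasCompactSupport ?_
    ((hc.fderiv_apply ℝ _).fderiv_apply ℝ _)
  have hfderiv : ContDiff ℝ ∞ fun x => fderiv ℝ Φ x (EuclideanSpace.basisFun (Fin n) ℝ i) :=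
    (hΦ.fderiv_right (m := ∞) (by simp)).clm_apply contDiff_const
  exact (hfderiv.continuous_fderiv (by simp)).clm_apply continuous_const

end IntegrationByParts

section Pairing

variable {n : ℕ} {Φ : Space n → ℝ}

lemma exists_clm_integral_mul (hΦ : MemLp Φ 2) :
    ∃ Λ : Lp ℝ 2 (volume : Measure (Space n)) →L[ℝ] ℝ,
      (fun w : Lp ℝ 2 (volume : Measure (Space n)) => ∫ x, w x * Φ x) = Λ := by
  refine ⟨innerSL ℝ (hΦ.toLp Φ), funext fun w => ?_⟩
  rw [innerSL_apply_apply, L2.inner_def]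
  refine integral_congr_ae ?_
  filter_upwards [hΦ.coeFn_toLp] with x hx
  simp [hx]

variable {w : ℝ → Lp ℝ 2 (volume : Measure (Space n))}

lemma continuousOn_integral_mul (hΦ : MemLp Φ 2) {S : Set ℝ} (hw : ContinuousOn w S) :
    ContinuousOn (fun t => ∫ x, w t x * Φ x) S := by
  obtain ⟨Λ, hΛ⟩ := exists_clm_integral_mul hΦ
  exact (hΛ ▸ Λ.continuous :
    Continuous fun w : Lp ℝ 2 (volume : Measure (Space n)) => ∫ x, w x * Φ x).comp_continuousOn hw

lemma hasDerivAt_integral_mul (hΦ : MemLp Φ 2) {w' : Lp ℝ 2 (volume : Measure (Space n))} {t : ℝ}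
    (hw : HasDerivAt w w' t) : HasDerivAt (fun t => ∫ x, w t x * Φ x) (∫ x, w' x * Φ x) t := by
  obtain ⟨Λ, hΛ⟩ := exists_clm_integral_mul hΦ
  have hcomp := Λ.hasFDerivAt.comp_hasDerivAt t hw
  rwa [← hΛ] at hcomp

end Pairing

section TimeInterval

variable {T : ℝ≥0∞} {t : ℝ}

lemma exists_gt_mem_timeInterval (ht : t ∈ timeInterval T) :
    ∃ t', t < t' ∧ t' ∈ timeInterval T := by
  obtain ⟨r, hr, htr, hrT⟩ := ENNReal.lt_iff_exists_real_btwn.1 ht.2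
  exact ⟨r, (ENNReal.ofReal_lt_ofReal_iff_of_nonneg ht.1).1 htr, hr, hrT⟩

lemma Icc_subset_timeInterval (ht : t ∈ timeInterval T) : Set.Icc 0 t ⊆ timeInterval T :=
  fun _ hs => ⟨hs.1, (ENNReal.ofReal_le_ofReal hs.2).trans_lt ht.2⟩

lemma timeInterval_mem_nhds (ht : t ∈ timeInterval T) (h0 : 0 < t) : timeInterval T ∈ 𝓝 t := by
  obtain ⟨t', htt', ht'⟩ := exists_gt_mem_timeInterval ht
  exact mem_of_superset (Icc_mem_nhds h0 htt') (Icc_subset_timeInterval ht')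

lemma exists_isTestFunction {n : ℕ} {Φ : Space n → ℝ} (hΦ : ContDiff ℝ ∞ Φ)
    (hΦc : HasCompactSupport Φ) (ht : t ∈ timeInterval T) :
    ∃ φ : Space n × ℝ → ℝ, IsTestFunction T φ ∧
      ∀ s ∈ Set.Icc 0 t, ∀ x, φ (x, s) = Φ x ∧ deriv (fun τ => φ (x, τ)) s = 0 := by
  obtain ⟨t', htt', ht'⟩ := exists_gt_mem_timeInterval ht
  have ht0 : 0 ≤ t := ht.1
  let η : ContDiffBump (0 : ℝ) := ⟨(t + t') / 2, t', by linarith, by linarith⟩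
  have hη : ∀ s ∈ Set.Icc 0 t, η =ᶠ[𝓝 s] 1 := fun s hs => by
    refine η.eventuallyEq_one_of_mem_ball (mem_ball_zero_iff.2 ?_)
    rw [Real.norm_of_nonneg hs.1]
    change s < (t + t') / 2
    linarith [hs.2]
  have hsupp : tsupport (fun z : Space n × ℝ => Φ z.1 * η z.2) ⊆ tsupport Φ ×ˢ tsupport η := by
    refine closure_minimal (fun z hz => ?_) ((isClosed_tsupport _).prod (isClosed_tsupport _))
    exact ⟨subset_tsupport _ (left_ne_zero_of_mul hz), subset_tsupport _ (right_ne_zero_of_mul hz)⟩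
  refine ⟨fun z => Φ z.1 * η z.2, ⟨?_, ?_, fun z hz => ?_⟩, fun s hs x => ⟨?_, ?_⟩⟩
  · exact (hΦ.comp contDiff_fst).mul ((η.contDiff (n := ⊤)).comp contDiff_snd)
  · exact (hΦc.isCompact.prod η.hasCompactSupport.isCompact).of_isClosed_subset
      (isClosed_tsupport _) hsupp
  · have hz2 : |z.2| ≤ t' := by
      simpa [η.tsupport_eq, Real.dist_eq] using (hsupp hz).2
    exact (ENNReal.ofReal_le_ofReal ((le_abs_self _).trans hz2)).trans_lt ht'.2
  · simp [(hη s hs).eq_of_nhds]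
  · have hconst : (fun τ => Φ x * η τ) =ᶠ[𝓝 s] fun _ => Φ x := by
      filter_upwards [hη s hs] with τ hτ
      rw [hτ, Pi.one_apply, mul_one]
    rw [hconst.deriv_eq, deriv_const]

end TimeInterval

namespace IsEnergySolution

variable {n : ℕ} {μ p ε : ℝ} {f g : Space n → ℝ} {T : ℝ≥0∞}
  {u v : ℝ → Lp ℝ 2 (volume : Measure (Space n))}
  {G : ℝ → Lp (Space n) 2 (volume : Measure (Space n))} {Φ : Space n → ℝ} {t : ℝ}

lemma integral_inner_gradient (h : IsEnergySolution μ p ε f g T u v G) (hΦ : ContDiff ℝ ∞ Φ)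
    (hΦc : HasCompactSupport Φ) (ht : t ∈ timeInterval T) :
    ∫ x, inner ℝ (G t x) (gradient Φ x) = -∫ x, u t x * Δ Φ x :=
  (h.weak_gradient t ht).integral_inner_gradient
    ((Lp.memLp (u t)).locallyIntegrable (by norm_num))
    ((Lp.memLp (G t)).locallyIntegrable (by norm_num)) hΦ hΦc

lemma intervalIntegrable_integral_rpow_mul (h : IsEnergySolution μ p ε f g T u v G)
    (hΦ : ContDiff ℝ ∞ Φ) (hΦc : HasCompactSupport Φ) (ht : t ∈ timeInterval T) :
    IntervalIntegrable (fun s => ∫ x, |u s x| ^ p * Φ x) volume 0 t := by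
  obtain ⟨φ, hφ, hφΦ⟩ := exists_isTestFunction hΦ hΦc ht
  refine (h.integrable_nonlinearity φ hφ t ht).congr fun s hs => ?_
  rw [Set.uIoc_of_le ht.1] at hs
  simp only [(hφΦ s (Set.Ioc_subset_Icc_self hs) _).1]

lemma continuousAt_integral_rpow_mul (h : IsEnergySolution μ p ε f g T u v G) (hp : 1 ≤ p)
    (hΦ : Continuous Φ) (hΦ0 : ∀ x, 0 ≤ Φ x) (hΦc : HasCompactSupport Φ)
    (ht : t ∈ timeInterval T) (ht0 : 0 < t) :
    ContinuousAt (fun s => ∫ x, |u s x| ^ p * Φ x) t := by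
  obtain ⟨c, hc⟩ := hΦc.exists_bound_of_continuous hΦ
  have hrestrict : ∀ s,
      ∫ x, |u s x| ^ p * Φ x = ∫ x in tsupport Φ, |u s x| ^ p * Φ x := fun s => by
    rw [setIntegral_eq_integral_of_forall_compl_eq_zero fun x hx => ?_]
    rw [image_eq_zero_of_notMem_tsupport hx, mul_zero]
  simp only [hrestrict]
  refine tendsto_integral_abs_rpow_mul hp hΦ.measurable hΦ0
    (fun x => (le_abs_self _).trans (hc x)) (h.memLp_loc t ht ht0 _ hΦc) ?_
    (h.continuous_Lp_loc t ht ht0 _ hΦc)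
  filter_upwards [timeInterval_mem_nhds ht ht0, Ioi_mem_nhds ht0] with s hs hs0
  exact h.memLp_loc s hs hs0 _ hΦc

lemma continuousOn_damping (h : IsEnergySolution μ p ε f g T u v G) (hΦ : MemLp Φ 2) :
    ContinuousOn (fun s => μ / (1 + s) * ∫ x, v s x * Φ x) (timeInterval T) := by
  refine (continuousOn_const.div (by fun_prop) fun s hs => ?_).mul
    (continuousOn_integral_mul hΦ h.continuous_v)
  have : 0 ≤ s := hs.1
  positivity

lemma continuousOn_linear_part (h : IsEnergySolution μ p ε f g T u v G) (hΦ : ContDiff ℝ ∞ Φ)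
    (hΦc : HasCompactSupport Φ) :
    ContinuousOn (fun s => (∫ x, u s x * Δ Φ x) - μ / (1 + s) * ∫ x, v s x * Φ x)
      (timeInterval T) :=
  (continuousOn_integral_mul (memLp_laplacian hΦ hΦc) h.continuous_u).sub
    (h.continuousOn_damping (hΦ.continuous.memLp_of_hasCompactSupport hΦc))

lemma energy_identity_spatial (h : IsEnergySolution μ p ε f g T u v G) (hΦ : ContDiff ℝ ∞ Φ)
    (hΦc : HasCompactSupport Φ) (ht : t ∈ timeInterval T) :
    (∫ x, v t x * Φ x) - (∫ x, v 0 x * Φ x) - (∫ s in (0 : ℝ)..t, ∫ x, u s x * Δ Φ x)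
      + (∫ s in (0 : ℝ)..t, μ / (1 + s) * ∫ x, v s x * Φ x)
    = ∫ s in (0 : ℝ)..t, ∫ x, |u s x| ^ p * Φ x := by
  obtain ⟨φ, hφ, hφΦ⟩ := exists_isTestFunction hΦ hΦc ht
  have hI : Set.uIcc 0 t ⊆ timeInterval T := by
    rw [Set.uIcc_of_le ht.1]; exact Icc_subset_timeInterval ht
  have hφeq : ∀ s ∈ Set.Icc 0 t, ∀ x, φ (x, s) = Φ x := fun s hs x => (hφΦ s hs x).1
  have hinitial : ∫ x, ε * g x * φ (x, 0) = ∫ x, v 0 x * Φ x := by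
    refine integral_congr_ae ?_
    filter_upwards [h.initial_v] with x hx
    rw [hφeq 0 ⟨le_rfl, ht.1⟩, hx]
  have hlaplacian : (∫ s in (0 : ℝ)..t, ∫ x, (-(v s x) * deriv (fun τ => φ (x, τ)) s
      + inner ℝ (G s x) (gradient (fun y => φ (y, s)) x)))
      = -∫ s in (0 : ℝ)..t, ∫ x, u s x * Δ Φ x := by
    rw [← intervalIntegral.integral_neg]
    refine intervalIntegral.integral_congr fun s hs => ?_
    have hφs : (fun y => φ (y, s)) = Φ := funext (hφeq s (Set.uIcc_of_le ht.1 ▸ hs))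
    simp only [(hφΦ s (Set.uIcc_of_le ht.1 ▸ hs) _).2, hφs, mul_zero, zero_add]
    exact h.integral_inner_gradient hΦ hΦc (hI hs)
  have hdamping : (∫ s in (0 : ℝ)..t, ∫ x, μ / (1 + s) * v s x * φ (x, s))
      = ∫ s in (0 : ℝ)..t, μ / (1 + s) * ∫ x, v s x * Φ x := by
    refine intervalIntegral.integral_congr fun s hs => ?_
    simp only [hφeq s (Set.uIcc_of_le ht.1 ▸ hs), mul_assoc, integral_const_mul]
  have hnonlinear : (∫ s in (0 : ℝ)..t, ∫ x, |u s x| ^ p * φ (x, s))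
      = ∫ s in (0 : ℝ)..t, ∫ x, |u s x| ^ p * Φ x :=
    intervalIntegral.integral_congr fun s hs => by
      simp only [hφeq s (Set.uIcc_of_le ht.1 ▸ hs)]
  have henergy := h.energy_identity φ hφ t ht
  rw [hinitial, hlaplacian, hdamping, hnonlinear] at henergy
  simpa only [hφeq t ⟨ht.1, le_rfl⟩, ← sub_eq_add_neg] using henergy

lemma integral_velocity_eq (h : IsEnergySolution μ p ε f g T u v G) (hΦ : ContDiff ℝ ∞ Φ)
    (hΦc : HasCompactSupport Φ) (ht : t ∈ timeInterval T) :
    ∫ x, v t x * Φ x = (∫ x, v 0 x * Φ x) + ∫ s in (0 : ℝ)..t,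
      (((∫ x, u s x * Δ Φ x) - μ / (1 + s) * ∫ x, v s x * Φ x) + ∫ x, |u s x| ^ p * Φ x) := by
  have hI : Set.uIcc 0 t ⊆ timeInterval T := by
    rw [Set.uIcc_of_le ht.1]; exact Icc_subset_timeInterval ht
  rw [intervalIntegral.integral_add
      ((h.continuousOn_linear_part hΦ hΦc).mono hI).intervalIntegrable
      (h.intervalIntegrable_integral_rpow_mul hΦ hΦc ht),
    intervalIntegral.integral_sub
      ((continuousOn_integral_mul (memLp_laplacian hΦ hΦc) h.continuous_u).mono
        hI).intervalIntegrable
      ((h.continuousOn_damping (hΦ.continuous.memLp_of_hasCompactSupport hΦc)).mono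
        hI).intervalIntegrable]
  linarith [h.energy_identity_spatial hΦ hΦc ht]

lemma hasDerivAt_integral_velocity (h : IsEnergySolution μ p ε f g T u v G) (hp : 1 ≤ p)
    (hΦ : ContDiff ℝ ∞ Φ) (hΦ0 : ∀ x, 0 ≤ Φ x) (hΦc : HasCompactSupport Φ)
    (ht : t ∈ timeInterval T) (ht0 : 0 < t) :
    HasDerivAt (fun s => ∫ x, v s x * Φ x)
      (((∫ x, u t x * Δ Φ x) - μ / (1 + t) * ∫ x, v t x * Φ x) + ∫ x, |u t x| ^ p * Φ x) t := by
  set F : ℝ → ℝ := fun s =>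
    ((∫ x, u s x * Δ Φ x) - μ / (1 + s) * ∫ x, v s x * Φ x) + ∫ x, |u s x| ^ p * Φ x
  have hlinear := h.continuousOn_linear_part hΦ hΦc
  have hcont : ∀ s ∈ timeInterval T, 0 < s → ContinuousAt F s := fun s hs hs0 =>
    (hlinear.continuousAt (timeInterval_mem_nhds hs hs0)).add
      (h.continuousAt_integral_rpow_mul hp hΦ.continuous hΦ0 hΦc hs hs0)
  have hint : IntervalIntegrable F volume 0 t := by
    refine IntervalIntegrable.add (hlinear.mono ?_).intervalIntegrable
      (h.intervalIntegrable_integral_rpow_mul hΦ hΦc ht)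
    rw [Set.uIcc_of_le ht.1]
    exact Icc_subset_timeInterval ht
  obtain ⟨t', htt', ht'⟩ := exists_gt_mem_timeInterval ht
  have hmeas : StronglyMeasurableAtFilter F (𝓝 t) :=
    ContinuousOn.stronglyMeasurableAtFilter isOpen_Ioo (fun s hs => (hcont s
      (Icc_subset_timeInterval ht' (Set.Ioo_subset_Icc_self hs)) hs.1).continuousWithinAt)
      t (⟨ht0, htt'⟩ : t ∈ Set.Ioo 0 t')
  refine ((intervalIntegral.integral_hasDerivAt_right hint hmeas (hcont t ht ht0)).const_add
    (∫ x, v 0 x * Φ x)).congr_of_eventuallyEq ?_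
  filter_upwards [timeInterval_mem_nhds ht ht0] with s hs
  exact h.integral_velocity_eq hΦ hΦc hs

lemma hasDerivAt_integral (h : IsEnergySolution μ p ε f g T u v G) (hΦ : MemLp Φ 2)
    (ht : t ∈ timeInterval T) (ht0 : 0 < t) :
    HasDerivAt (fun s => ∫ x, u s x * Φ x) (∫ x, v t x * Φ x) t :=
  hasDerivAt_integral_mul hΦ ((h.hasDeriv t ht).hasDerivAt (timeInterval_mem_nhds ht ht0))

lemma integral_initial_velocity (h : IsEnergySolution μ p ε f g T u v G) {m : ℝ}
    (hfg : ∀ᵐ x, m * f x + g x = 0) : ∫ x, v 0 x * Φ x = -(m * ∫ x, u 0 x * Φ x) := by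
  rw [← integral_const_mul, ← integral_neg]
  refine integral_congr_ae ?_
  filter_upwards [h.initial_u, h.initial_v, hfg] with x hu hv hx
  rw [hu, hv]
  linear_combination ε * Φ x * hx

end IsEnergySolution

namespace SupportedInCone

variable {n : ℕ} {R : ℝ} {T : ℝ≥0∞} {u : ℝ → Lp ℝ 2 (volume : Measure (Space n))}
  {Φ ψ : Space n → ℝ} {t : ℝ}

lemma integral_comp_mul (h : SupportedInCone R T u) (ht : t ∈ timeInterval T)
    (hΦ : ∀ x, ‖x‖ ≤ t + R → Φ x = ψ x) {F : ℝ → ℝ} (hF : F 0 = 0) :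
    ∫ x, F (u t x) * Φ x = ∫ x in Metric.closedBall 0 (t + R), F (u t x) * ψ x := by
  rw [← integral_indicator measurableSet_closedBall]
  refine integral_congr_ae ?_
  filter_upwards [h t ht] with x hx
  by_cases hxt : ‖x‖ ≤ t + R
  · rw [Set.indicator_of_mem (by simpa using hxt), hΦ x hxt]
  · rw [Set.indicator_of_notMem (by simpa using hxt), hx (not_le.1 hxt), hF, zero_mul]

lemma integral_mul_laplacian (h : SupportedInCone R T u) (ht : t ∈ timeInterval T)
    {ρ : ℝ} (hρ : t + R < ρ) (hΦ : ∀ x, ‖x‖ < ρ → Φ x = ψ x) {l : ℝ}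
    (hl : ∀ x, Δ ψ x = l * ψ x) : ∫ x, u t x * Δ Φ x = l * ∫ x, u t x * Φ x := by
  rw [← integral_const_mul]
  refine integral_congr_ae ?_
  filter_upwards [h t ht] with x hx
  by_cases hxt : t + R < ‖x‖
  · simp [hx hxt]
  · have hΦψ : Φ =ᶠ[𝓝 x] ψ := by
      filter_upwards [Metric.isOpen_ball.mem_nhds
        (mem_ball_zero_iff.2 ((not_lt.1 hxt).trans_lt hρ))] with y hy
      exact hΦ y (mem_ball_zero_iff.1 hy)
    rw [(InnerProductSpace.laplacian_congr_nhds hΦψ).eq_of_nhds, hl, ← hΦψ.eq_of_nhds]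
    ring

end SupportedInCone

lemma exists_hasCompactSupport_eq_of_norm_lt {n : ℕ} {ψ : Space n → ℝ} (hψ : ContDiff ℝ ∞ ψ)
    (hψ0 : ∀ x, 0 ≤ ψ x) {ρ : ℝ} (hρ : 0 < ρ) :
    ∃ Φ : Space n → ℝ, ContDiff ℝ ∞ Φ ∧ HasCompactSupport Φ ∧ (∀ x, 0 ≤ Φ x) ∧
      ∀ x, ‖x‖ < ρ → Φ x = ψ x := by
  let χ : ContDiffBump (0 : Space n) := ⟨ρ, ρ + 1, hρ, by linarith⟩
  refine ⟨fun x => χ x * ψ x, (χ.contDiff (n := ⊤)).mul hψ, χ.hasCompactSupport.mul_right,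
    fun x => mul_nonneg χ.nonneg (hψ0 x), fun x hx => ?_⟩
  have hχ : χ x = 1 := χ.one_of_mem_closedBall (mem_closedBall_zero_iff.2 hx.le)
  simp only [hχ, one_mul]

lemma IsEnergySolution.setIntegral_initial_mul {n : ℕ} {μ p ε : ℝ} {f g : Space n → ℝ} {T : ℝ≥0∞}
    {u v : ℝ → Lp ℝ 2 (volume : Measure (Space n))}
    {G : ℝ → Lp (Space n) 2 (volume : Measure (Space n))}
    (h : IsEnergySolution μ p ε f g T u v G) (ψ : Space n → ℝ) (K : Set (Space n)) :
    ∫ x in K, u 0 x * ψ x = ε * ∫ x in K, f x * ψ x := by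
  rw [← integral_const_mul]
  refine integral_congr_ae (ae_restrict_of_ae ?_)
  filter_upwards [h.initial_u] with x hx
  rw [hx, mul_assoc]

-- The shift `s = 1 + t` turns the damping `μ / (1 + t)` into `μ / s`.
theorem IsEnergySolution.dampedODE {n : ℕ} {μ p ε R : ℝ} {f g : Space n → ℝ} {T : ℝ≥0∞}
    {u v : ℝ → Lp ℝ 2 (volume : Measure (Space n))}
    {G : ℝ → Lp (Space n) 2 (volume : Measure (Space n))}
    (h : IsEnergySolution μ p ε f g T u v G) (hp : 1 ≤ p) (hR : 0 ≤ R)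
    (hcone : SupportedInCone R T u) {t₁ : ℝ} (ht₁ : t₁ ∈ timeInterval T)
    {ψ : Space n → ℝ} (hψ : ContDiff ℝ ∞ ψ) (hψ0 : ∀ x, 0 ≤ ψ x) {l : ℝ}
    (hl : ∀ x, Δ ψ x = l * ψ x) {m : ℝ} (hfg : ∀ᵐ x, m * f x + g x = 0) :
    ∃ Y Z r : ℝ → ℝ, DampedODE μ l (1 + t₁) Y Z r ∧
      Y 1 = ε * ∫ x in Metric.closedBall 0 R, f x * ψ x ∧ Z 1 = -(m * Y 1) ∧
      ∀ s ∈ Set.Icc 1 (1 + t₁),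
        Y s = ∫ x in Metric.closedBall 0 (s - 1 + R), u (s - 1) x * ψ x ∧
        r s = ∫ x in Metric.closedBall 0 (s - 1 + R), |u (s - 1) x| ^ p * ψ x := by
  have ht₁0 : 0 ≤ t₁ := ht₁.1
  obtain ⟨Φ, hΦ, hΦc, hΦ0, hΦψ⟩ :=
    exists_hasCompactSupport_eq_of_norm_lt hψ hψ0 (ρ := t₁ + R + 1) (by linarith)
  have hΦ2 : MemLp Φ 2 := hΦ.continuous.memLp_of_hasCompactSupport hΦc
  have hI : Set.Icc 0 t₁ ⊆ timeInterval T := Icc_subset_timeInterval ht₁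
  have hball : ∀ t ∈ Set.Icc 0 t₁, ∀ F : ℝ → ℝ, F 0 = 0 →
      ∫ x, F (u t x) * Φ x = ∫ x in Metric.closedBall 0 (t + R), F (u t x) * ψ x :=
    fun t ht F hF => hcone.integral_comp_mul (hI ht)
      (fun x hx => hΦψ x (by linarith [ht.2])) hF
  have hshift : ∀ s ∈ Set.Icc 1 (1 + t₁), s - 1 ∈ Set.Icc 0 t₁ := fun s hs =>
    ⟨by linarith [hs.1], by linarith [hs.2]⟩
  have hY1 : ∫ x, u 0 x * Φ x = ε * ∫ x in Metric.closedBall 0 R, f x * ψ x := by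
    simpa only [id, zero_add, h.setIntegral_initial_mul] using hball 0 ⟨le_rfl, ht₁0⟩ id rfl
  refine ⟨fun s => ∫ x, u (s - 1) x * Φ x, fun s => ∫ x, v (s - 1) x * Φ x,
    fun s => ∫ x, |u (s - 1) x| ^ p * Φ x, ⟨?_, ?_, fun s hs => ?_, fun s hs => ?_, ?_⟩, ?_, ?_,
    fun s hs => ⟨?_, ?_⟩⟩
  · exact (continuousOn_integral_mul hΦ2 (h.continuous_u.mono hI)).comp (by fun_prop) hshift
  · exact (continuousOn_integral_mul hΦ2 (h.continuous_v.mono hI)).comp (by fun_prop) hshift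
  · exact (h.hasDerivAt_integral hΦ2 (hI (hshift s (Set.Ioo_subset_Icc_self hs)))
      (by linarith [hs.1])).comp_sub_const s 1
  · have hs' := hI (hshift s (Set.Ioo_subset_Icc_self hs))
    have hderiv := (h.hasDerivAt_integral_velocity hp hΦ hΦ0 hΦc hs'
      (by linarith [hs.1])).comp_sub_const s 1
    rw [hcone.integral_mul_laplacian hs' (by linarith [hs.2]) hΦψ hl] at hderiv
    rw [add_sub_cancel, sub_add_eq_add_sub] at hderiv
    exact hderiv
  · exact fun s _ => integral_nonneg fun x => mul_nonneg (by positivity) (hΦ0 x)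
  · simpa only [sub_self] using hY1
  · simpa only [sub_self] using h.integral_initial_velocity hfg
  · exact hball (s - 1) (hshift s hs) id rfl
  · exact hball (s - 1) (hshift s hs) (fun y => |y| ^ p) (by simp [(by linarith : p ≠ 0)])

/-! ### Lower bounds for the nonlinear term -/

section Holder

variable {α : Type*} [MeasurableSpace α] {ν : Measure α} {p : ℝ} {w ψ : α → ℝ}

lemma integral_mul_rpow_le_mul_rpow (hp : 1 < p) (hw : MemLp w (ENNReal.ofReal p) ν)
    (hψ : MemLp ψ (ENNReal.ofReal (p / (p - 1))) ν) (hψ0 : ∀ x, 0 ≤ ψ x)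
    (hwψ : 0 ≤ ∫ x, w x * ψ x ∂ν) :
    (∫ x, w x * ψ x ∂ν) ^ p ≤
      (∫ x, |w x| ^ p ∂ν) * (∫ x, ψ x ^ (p / (p - 1)) ∂ν) ^ (p - 1) := by
  have hp0 : 0 < p := one_pos.trans hp
  have habs : ∫ x, w x * ψ x ∂ν ≤ ∫ x, |w x| * ψ x ∂ν := by
    refine ((le_abs_self _).trans abs_integral_le_integral_abs).trans_eq (integral_congr_ae ?_)
    exact .of_forall fun x => by simp only [abs_mul, abs_of_nonneg (hψ0 x)]
  have hholder := integral_mul_le_Lp_mul_Lq_of_nonneg (Real.HolderConjugate.conjExponent hp)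
    (.of_forall fun x => abs_nonneg (w x)) (.of_forall hψ0) hw.abs hψ
  have hw0 : 0 ≤ ∫ x, |w x| ^ p ∂ν := integral_nonneg fun x => Real.rpow_nonneg (abs_nonneg _) _
  have hψq0 : 0 ≤ ∫ x, ψ x ^ (p / (p - 1)) ∂ν :=
    integral_nonneg fun x => Real.rpow_nonneg (hψ0 x) _
  refine (Real.rpow_le_rpow hwψ (habs.trans hholder) hp0.le).trans_eq ?_
  rw [Real.conjExponent, Real.mul_rpow (Real.rpow_nonneg hw0 _) (Real.rpow_nonneg hψq0 _),
    ← Real.rpow_mul hw0, ← Real.rpow_mul hψq0, one_div_mul_cancel hp0.ne', Real.rpow_one,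
    one_div_div, div_mul_cancel₀ _ hp0.ne']

lemma integral_rpow_le_mul_measureReal_rpow [IsFiniteMeasure ν] (hp : 1 < p)
    (hw : MemLp w (ENNReal.ofReal p) ν) (hw0 : 0 ≤ ∫ x, w x ∂ν) :
    (∫ x, w x ∂ν) ^ p ≤ (∫ x, |w x| ^ p ∂ν) * ν.real Set.univ ^ (p - 1) := by
  simpa only [mul_one, Real.one_rpow, integral_const, smul_eq_mul] using
    integral_mul_rpow_le_mul_rpow hp hw (memLp_const (1 : ℝ)) (fun _ => zero_le_one)
      (by simpa only [mul_one] using hw0)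

lemma setIntegral_mul_pos {K : Set α} (hK : MeasurableSet K)
    (hwψ : IntegrableOn (fun x => w x * ψ x) K ν) (hw0 : ∀ᵐ x ∂ν, 0 ≤ w x)
    (hw_ne : ¬ ∀ᵐ x ∂ν, w x = 0) (hw_supp : ∀ᵐ x ∂ν, x ∉ K → w x = 0) (hψ0 : ∀ x, 0 < ψ x) :
    0 < ∫ x in K, w x * ψ x ∂ν := by
  have hnonneg : 0 ≤ᵐ[ν.restrict K] fun x => w x * ψ x := by
    filter_upwards [ae_restrict_of_ae hw0] with x hx
    exact mul_nonneg hx (hψ0 x).le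
  refine (integral_nonneg_of_ae hnonneg).lt_of_ne fun hzero => hw_ne ?_
  filter_upwards [(ae_restrict_iff' hK).1
    ((integral_eq_zero_iff_of_nonneg_ae hnonneg hwψ).1 hzero.symm), hw_supp] with x hx hx'
  by_cases hxK : x ∈ K
  · exact (mul_eq_zero.1 (hx hxK)).resolve_right (hψ0 x).ne'
  · exact hx' hxK

end Holder

lemma memLp_closedBall_of_continuous {n : ℕ} {ψ : Space n → ℝ} (hψ : Continuous ψ) (q : ℝ≥0∞)
    (X : ℝ) : MemLp ψ q (volume.restrict (Metric.closedBall 0 X)) := by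
  have : IsFiniteMeasure (volume.restrict (Metric.closedBall (0 : Space n) X)) :=
    isFiniteMeasure_restrict.2 measure_closedBall_lt_top.ne
  obtain ⟨C, hC⟩ := (isCompact_closedBall (0 : Space n) X).exists_bound_of_continuousOn
    hψ.continuousOn
  exact .of_bound hψ.aestronglyMeasurable C
    ((ae_restrict_iff' measurableSet_closedBall).2 (.of_forall hC))

lemma rpow_le_rpow_abs_mul (Q : ℝ) {x y C : ℝ} (hx : 0 < x) (hy : 0 < y) (hxy : x ≤ C * y)
    (hyx : y ≤ C * x) : x ^ Q ≤ C ^ |Q| * y ^ Q := by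
  have hC : 0 < C := pos_of_mul_pos_left (hx.trans_le hxy) hy.le
  rcases le_total 0 Q with hQ | hQ
  · rw [abs_of_nonneg hQ, ← Real.mul_rpow hC.le hy.le]
    exact Real.rpow_le_rpow hx.le hxy hQ
  · rw [abs_of_nonpos hQ, Real.rpow_neg hC.le, ← Real.inv_rpow hC.le,
      ← Real.mul_rpow (inv_pos.2 hC).le hy.le]
    exact Real.rpow_le_rpow_of_nonpos (by positivity) ((inv_mul_le_iff₀ hC).2 hyx) hQ

lemma exists_integral_mul_radialEigen_rpow_le {n : ℕ} (hn : 1 ≤ n) {p : ℝ} (hp : 1 < p) :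
    ∃ C : ℝ, 0 < C ∧ ∀ (X : ℝ) (w : Space n → ℝ), 0 ≤ X →
      MemLp w (ENNReal.ofReal p) (volume.restrict (Metric.closedBall 0 X)) →
      0 ≤ ∫ x in Metric.closedBall 0 X, w x * radialEigen x →
      (∫ x in Metric.closedBall 0 X, w x * radialEigen x) ^ p ≤
        (∫ x in Metric.closedBall 0 X, |w x| ^ p) *
          (C * ((1 + X) ^ (((n : ℝ) - 1) * (p / 2 - 1)) * Real.exp (p * X))) := by
  have hp1 : 0 < p - 1 := sub_pos.2 hp
  obtain ⟨C, hC, hint⟩ := exists_integral_radialEigen_rpow_le hn (div_pos (one_pos.trans hp) hp1)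
  refine ⟨C ^ (p - 1), Real.rpow_pos_of_pos hC _, fun X w hX hw hwφ => ?_⟩
  have hφ0 : ∀ x : Space n, 0 ≤ radialEigen x :=
    fun x => zero_le_one.trans (one_le_radialEigen hn x)
  refine (integral_mul_rpow_le_mul_rpow hp hw (memLp_closedBall_of_continuous
    (contDiff_radialEigen hn).continuous _ X) hφ0 hwφ).trans ?_
  refine mul_le_mul_of_nonneg_left ?_
    (integral_nonneg fun x => Real.rpow_nonneg (abs_nonneg _) _)
  refine (Real.rpow_le_rpow (integral_nonneg fun x => Real.rpow_nonneg (hφ0 x) _)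
    (hint X hX) hp1.le).trans_eq ?_
  have hX1 : 0 ≤ 1 + X := by linarith
  rw [Real.mul_rpow hC.le (by positivity), Real.mul_rpow (by positivity) (Real.exp_pos _).le,
    ← Real.rpow_mul hX1, ← Real.exp_mul]
  congr 3 <;> field_simp
  ring

/-! ### The differential inequality for the total mass -/

/-- The total mass `Y s = ∫ u(s - 1)` of a solution, with derivative `Z`, solves a damped equation
forced by `r s = ∫ |u(s - 1)| ^ p`. The forcing dominates a power of the mass (Hölder on the cone)
and, independently of the mass, a power of `s` coming from the initial data of size `ε`. -/
structure MassODE (n : ℕ) (μ p m I c₀ c₁ ε b : ℝ) (Y Z r : ℝ → ℝ) : Prop where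
  ode : DampedODE μ 0 b Y Z r
  init : Y 1 = ε * I
  init_deriv : Z 1 = -(m * (ε * I))
  le_of_mass : ∀ s ∈ Set.Ioc 1 b, 0 ≤ Y s → c₀ * s ^ (-(n * (p - 1))) * Y s ^ p ≤ r s
  le_of_data : ∀ s ∈ Set.Ioc 1 b, c₁ * ε ^ p * s ^ ((n : ℝ) - 1 - (n + μ - 1) * p / 2) ≤ r s

section Mass

variable {n : ℕ} {μ p R m : ℝ} {f g : Space n → ℝ}

lemma IsEnergySolution.memLp_closedBall {ε T u v G} (h : IsEnergySolution μ p ε f g T u v G)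
    {t₁ : ℝ} (ht₁ : t₁ ∈ timeInterval T) {s : ℝ} (hs : s ∈ Set.Ioc 1 (1 + t₁)) (X : ℝ) :
    MemLp (u (s - 1)) (ENNReal.ofReal p) (volume.restrict (Metric.closedBall 0 X)) :=
  h.memLp_loc _ (Icc_subset_timeInterval ht₁ ⟨by linarith [hs.1], by linarith [hs.2]⟩)
    (by linarith [hs.1]) _ (isCompact_closedBall _ _)

lemma exists_mul_integral_rpow_le (n : ℕ) (hp : 1 < p) (hR : 1 ≤ R) :
    ∃ c : ℝ, 0 < c ∧ ∀ (s : ℝ) (w : Space n → ℝ), 1 ≤ s →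
      MemLp w (ENNReal.ofReal p) (volume.restrict (Metric.closedBall 0 (s - 1 + R))) →
      0 ≤ ∫ x in Metric.closedBall 0 (s - 1 + R), w x →
      c * s ^ (-(n * (p - 1))) * (∫ x in Metric.closedBall 0 (s - 1 + R), w x) ^ p ≤
        ∫ x in Metric.closedBall 0 (s - 1 + R), |w x| ^ p := by
  have hp1 : 0 < p - 1 := sub_pos.2 hp
  set V : ℝ := volume.real (Metric.ball (0 : Space n) 1) with hV
  have hV0 : 0 < V :=
    ENNReal.toReal_pos (Metric.measure_ball_pos _ _ one_pos).ne' measure_ball_lt_top.ne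
  refine ⟨((R ^ n * V) ^ (p - 1))⁻¹, by positivity, fun s w hs hw hw0 => ?_⟩
  have hs0 : 0 < s := one_pos.trans_le hs
  have : IsFiniteMeasure (volume.restrict (Metric.closedBall (0 : Space n) (s - 1 + R))) :=
    isFiniteMeasure_restrict.2 measure_closedBall_lt_top.ne
  have hvol : volume.real (Metric.closedBall (0 : Space n) (s - 1 + R)) ≤ R ^ n * V * s ^ n := by
    rw [Measure.addHaar_real_closedBall _ _ (by linarith), finrank_euclideanSpace_fin, ← hV,
      mul_right_comm, ← mul_pow]
    have hcone : s - 1 + R ≤ R * s := by nlinarith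
    gcongr
  have hholder := integral_rpow_le_mul_measureReal_rpow hp hw hw0
  rw [measureReal_restrict_apply_univ] at hholder
  rw [Real.rpow_neg hs0.le, ← mul_inv, inv_mul_le_iff₀ (by positivity), mul_comm]
  refine hholder.trans (mul_le_mul_of_nonneg_left ?_
    (integral_nonneg fun x => Real.rpow_nonneg (abs_nonneg _) _))
  refine (Real.rpow_le_rpow measureReal_nonneg hvol hp1.le).trans_eq ?_
  rw [Real.mul_rpow (by positivity) (by positivity), ← Real.rpow_natCast s,
    ← Real.rpow_mul hs0.le]

lemma exists_integral_radialEigen_rpow_le_of_cone (hn : 1 ≤ n) (hp : 1 < p) (hR : 1 ≤ R) :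
    ∃ C : ℝ, 0 < C ∧ ∀ (s : ℝ) (w : Space n → ℝ), 1 ≤ s →
      MemLp w (ENNReal.ofReal p) (volume.restrict (Metric.closedBall 0 (s - 1 + R))) →
      0 ≤ ∫ x in Metric.closedBall 0 (s - 1 + R), w x * radialEigen x →
      (∫ x in Metric.closedBall 0 (s - 1 + R), w x * radialEigen x) ^ p ≤
        C * (s ^ (((n : ℝ) - 1) * (p / 2 - 1)) * Real.exp (p * s)) *
          ∫ x in Metric.closedBall 0 (s - 1 + R), |w x| ^ p := by
  obtain ⟨C, hC, hholder⟩ := exists_integral_mul_radialEigen_rpow_le hn hp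
  obtain ⟨Q, hQ⟩ : ∃ Q, Q = ((n : ℝ) - 1) * (p / 2 - 1) := ⟨_, rfl⟩
  rw [← hQ] at hholder ⊢
  have : 0 < 1 + R := by linarith
  refine ⟨C * (1 + R) ^ |Q| * Real.exp (p * (R - 1)), by positivity, fun s w hs hw hwφ => ?_⟩
  have hs0 : 0 < s := one_pos.trans_le hs
  have hcone : (1 + (s - 1 + R)) ^ Q ≤ (1 + R) ^ |Q| * s ^ Q :=
    rpow_le_rpow_abs_mul Q (by linarith) hs0 (by nlinarith) (by nlinarith)
  rw [mul_comm _ (∫ x in Metric.closedBall 0 (s - 1 + R), |w x| ^ p)]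
  refine (hholder _ w (by linarith) hw hwφ).trans (mul_le_mul_of_nonneg_left ?_
    (integral_nonneg fun x => Real.rpow_nonneg (abs_nonneg _) _))
  calc C * ((1 + (s - 1 + R)) ^ Q * Real.exp (p * (s - 1 + R)))
      ≤ C * ((1 + R) ^ |Q| * s ^ Q * Real.exp (p * (R - 1) + p * s)) := by
        rw [show p * (s - 1 + R) = p * (R - 1) + p * s by ring]
        gcongr
    _ = C * (1 + R) ^ |Q| * Real.exp (p * (R - 1)) * (s ^ Q * Real.exp (p * s)) := by
        rw [Real.exp_add]
        ring

lemma exists_data_rpow_le_integral (hn : 1 ≤ n) (hp : 1 < p) (hR : 1 ≤ R)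
    (hm : m * (m + 1 - μ) = 0) (hf : LocallyIntegrable f) (hf_nonneg : ∀ᵐ x, 0 ≤ f x)
    (hf_ne : ¬ ∀ᵐ x, f x = 0) (hf_supp : ∀ᵐ x, R < ‖x‖ → f x = 0)
    (hfg : ∀ᵐ x, m * f x + g x = 0) :
    ∃ c : ℝ, 0 < c ∧ ∀ ε T u v G, 0 < ε → IsEnergySolution μ p ε f g T u v G →
      SupportedInCone R T u → ∀ t₁ ∈ timeInterval T, ∀ s ∈ Set.Ioc 1 (1 + t₁),
        c * ε ^ p * s ^ ((n : ℝ) - 1 - (n + μ - 1) * p / 2) ≤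
          ∫ x in Metric.closedBall 0 (s - 1 + R), |u (s - 1) x| ^ p := by
  have hφ0 : ∀ x : Space n, 0 < radialEigen x :=
    fun x => one_pos.trans_le (one_le_radialEigen hn x)
  obtain ⟨c, hc, hgrowth⟩ := DampedODE.exists_growth_lower_of_initial hm
  obtain ⟨C, hC, hholder⟩ := exists_integral_radialEigen_rpow_le_of_cone hn hp hR
  set A := ∫ x in Metric.closedBall 0 R, f x * radialEigen x with hA
  have hA0 : 0 < A := setIntegral_mul_pos measurableSet_closedBall
    ((hf.integrableOn_isCompact (isCompact_closedBall _ _)).mul_continuousOn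
      (contDiff_radialEigen hn).continuous.continuousOn (isCompact_closedBall _ _))
    hf_nonneg hf_ne (by simpa only [mem_closedBall_zero_iff, not_le] using hf_supp) hφ0
  refine ⟨(c * A) ^ p / C, by positivity, fun ε T u v G hε h hcone t₁ ht₁ s hs => ?_⟩
  obtain ⟨Y, Z, r, hode, hY1, hZ1, hYr⟩ := h.dampedODE hp.le (zero_le_one.trans hR) hcone ht₁
    (contDiff_radialEigen hn) (fun x => (hφ0 x).le) (l := 1)
    (fun x => by rw [laplacian_radialEigen hn, one_mul]) hfg
  have hs0 : 0 < s := one_pos.trans hs.1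
  have hYlow := hgrowth _ Y Z r hode (hY1 ▸ mul_pos hε hA0) hZ1 s (Set.Ioc_subset_Icc_self hs)
  rw [hY1, ← hA] at hYlow
  obtain ⟨hYs, -⟩ := hYr s (Set.Ioc_subset_Icc_self hs)
  have hlow0 : 0 ≤ c * (ε * A) * (s ^ (-(μ / 2)) * Real.exp s) := by positivity
  have hcompare := (Real.rpow_le_rpow hlow0 hYlow (by linarith)).trans (hYs ▸ hholder s (u (s - 1))
    hs.1.le (h.memLp_closedBall ht₁ hs _) (hYs ▸ hlow0.trans hYlow))
  refine le_of_mul_le_mul_left (le_of_eq_of_le ?_ hcompare) (by positivity)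
  rw [show (n : ℝ) - 1 - (n + μ - 1) * p / 2 = -(μ / 2) * p - (n - 1) * (p / 2 - 1) by ring,
    Real.rpow_sub hs0, show c * (ε * A) = c * A * ε by ring,
    Real.mul_rpow (x := c * A * ε) (by positivity) (by positivity),
    Real.mul_rpow (by positivity) hε.le,
    Real.mul_rpow (Real.rpow_nonneg hs0.le _) (Real.exp_pos _).le, ← Real.rpow_mul hs0.le,
    ← Real.exp_mul, mul_comm s p]
  field_simp

theorem exists_lifespan_le_of_forall_not_massODE (hn : 1 ≤ n) (hp : 1 < p) (hR : 1 ≤ R)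
    (hm : m * (m + 1 - μ) = 0) (hf : LocallyIntegrable f) (hf_nonneg : ∀ᵐ x, 0 ≤ f x)
    (hf_ne : ¬ ∀ᵐ x, f x = 0) (hfg : ∀ᵐ x, m * f x + g x = 0) :
    ∃ I c₀ c₁ : ℝ, 0 < I ∧ 0 < c₀ ∧ 0 < c₁ ∧ ∀ ε B : ℝ, 0 < ε → 0 ≤ B →
      (∀ Y Z r : ℝ → ℝ, ¬ MassODE n μ p m I c₀ c₁ ε (1 + B) Y Z r) →
      lifespan μ p R f g ε ≤ ENNReal.ofReal B := by
  by_cases hf_supp : ∀ᵐ x, R < ‖x‖ → f x = 0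
  · obtain ⟨c₀, hc₀, hmass⟩ := exists_mul_integral_rpow_le n hp hR
    obtain ⟨c₁, hc₁, hdata⟩ :=
      exists_data_rpow_le_integral hn hp hR hm hf hf_nonneg hf_ne hf_supp hfg
    refine ⟨∫ x in Metric.closedBall 0 R, f x, c₀, c₁, ?_, hc₀, hc₁, fun ε B hε hB hnot => ?_⟩
    · simpa only [mul_one] using setIntegral_mul_pos (ψ := fun _ => 1) measurableSet_closedBall
        (by simpa only [mul_one] using hf.integrableOn_isCompact (isCompact_closedBall _ _))
        hf_nonneg hf_ne (by simpa only [mem_closedBall_zero_iff, not_le] using hf_supp)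
        fun _ => one_pos
    · refine sSup_le fun T ⟨u, v, G, hsol, hcone⟩ => le_of_not_gt fun hBT => ?_
      obtain ⟨Y, Z, r, hode, hY1, hZ1, hYr⟩ := hsol.dampedODE hp.le (zero_le_one.trans hR) hcone
        ⟨hB, hBT⟩ (ψ := fun _ => 1) contDiff_const (fun _ => zero_le_one) (l := 0)
        (fun x => by simp) hfg
      simp only [mul_one] at hY1 hYr
      refine hnot Y Z r ⟨hode, hY1, hY1 ▸ hZ1, fun s hs hYs => ?_, fun s hs => ?_⟩
      · obtain ⟨hY, hr⟩ := hYr s (Set.Ioc_subset_Icc_self hs)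
        rw [hr, hY]
        exact hmass s _ hs.1.le (hsol.memLp_closedBall ⟨hB, hBT⟩ hs _) (hY ▸ hYs)
      · rw [(hYr s (Set.Ioc_subset_Icc_self hs)).2]
        exact hdata ε T u v G hε hsol hcone B ⟨hB, hBT⟩ s hs
  · refine ⟨1, 1, 1, one_pos, one_pos, one_pos, fun ε B hε _ _ => ?_⟩
    refine sSup_le fun T ⟨u, v, G, hsol, hcone⟩ => absurd ?_ hf_supp
    filter_upwards [hcone 0 ⟨le_rfl, by simpa using hsol.T_pos⟩, hsol.initial_u] with x hx hux hxR
    exact (mul_eq_zero.1 (hux ▸ hx (by simpa using hxR))).resolve_left hε.ne'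

end Mass

-- `log s + (s ^ (-m) - 1) / m` solves `w'' + (m + 1) w' / s = m / s²` with `w 1 = w' 1 = 0`.
lemma DampedODE.sub_mul_log {m b k : ℝ} {Y Z r : ℝ → ℝ} (hm : m ≠ 0)
    (h : DampedODE (m + 1) 0 b Y Z r) (hr : ∀ s ∈ Set.Ioo 1 b, k * m / s ^ 2 ≤ r s) :
    DampedODE (m + 1) 0 b (fun s => Y s - k * (Real.log s + (s ^ (-m) - 1) / m))
      (fun s => Z s - k * (s⁻¹ - s ^ (-m - 1))) (fun s => r s - k * m / s ^ 2) where
  cont := h.cont.sub (continuousOn_const.mul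
    ((Real.continuousOn_log.mono fun s hs => (one_pos.trans_le hs.1).ne').add
      (((continuousOn_rpow_Icc _ one_pos).sub continuousOn_const).div_const m)))
  cont_deriv := h.cont_deriv.sub (continuousOn_const.mul
    ((continuousOn_inv₀.mono fun s hs => (one_pos.trans_le hs.1).ne').sub
      (continuousOn_rpow_Icc _ one_pos)))
  hasDerivAt s hs := by
    have hs0 : s ≠ 0 := (one_pos.trans hs.1).ne'
    have hrpow := Real.hasDerivAt_rpow_const (p := -m) (Or.inl hs0)
    refine ((h.hasDerivAt s hs).fun_sub (((Real.hasDerivAt_log hs0).fun_add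
      ((hrpow.sub_const 1).div_const m)).const_mul k)).congr_deriv ?_
    field_simp
    ring
  hasDerivAt_deriv s hs := by
    have hs0 : s ≠ 0 := (one_pos.trans hs.1).ne'
    refine ((h.hasDerivAt_deriv s hs).fun_sub (((hasDerivAt_inv hs0).fun_sub
      (Real.hasDerivAt_rpow_const (p := -m - 1) (Or.inl hs0))).const_mul k)).congr_deriv ?_
    rw [Real.rpow_sub_one hs0 (-m - 1)]
    field_simp
    ring
  nonneg s hs := sub_nonneg.2 (hr s hs)

namespace MassODE

variable {n : ℕ} {μ p m I c₀ c₁ : ℝ}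

lemma exists_blowup_bound (hμ : 0 ≤ μ) (hp : 1 < p) (hm : m * (m + 1 - μ) = 0) (hI : 0 ≤ I)
    (hc₀ : 0 < c₀) :
    ∃ K : ℝ, ∀ (ε S A : ℝ) (Y Z r : ℝ → ℝ), 0 < ε → 1 ≤ S → 0 < A →
      MassODE n μ p m I c₀ c₁ ε (2 * S) Y Z r → (∀ s ∈ Set.Icc S (2 * S), A ≤ Y s) →
      A ^ (p - 1) * S ^ (2 - n * (p - 1)) ≤ K := by
  obtain ⟨K, hblowup⟩ := DampedODE.exists_blowup_bound hμ hp
  have hn : 0 ≤ n * (p - 1) := mul_nonneg n.cast_nonneg (sub_pos.2 hp).le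
  set k : ℝ := c₀ * 2 ^ (-(n * (p - 1))) with hk
  have hk0 : 0 < k := by positivity
  refine ⟨K / k, fun ε S A Y Z r hε hS hA h hAY => ?_⟩
  have hS0 : 0 < S := one_pos.trans_le hS
  have hforce : ∀ s ∈ Set.Ioo S (2 * S), k * S ^ (-(n * (p - 1))) * Y s ^ p ≤ r s := by
    intro s hs
    have hY0 : 0 ≤ Y s := hA.le.trans (hAY s (Set.Ioo_subset_Icc_self hs))
    refine le_trans ?_ (h.le_of_mass s ⟨hS.trans_lt hs.1, hs.2.le⟩ hY0)
    rw [hk, mul_assoc c₀, ← Real.mul_rpow two_pos.le hS0.le]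
    have hmono := Real.rpow_le_rpow_of_nonpos (hS0.trans hs.1) hs.2.le (neg_nonpos.2 hn)
    gcongr
  rw [le_div_iff₀ hk0]
  calc A ^ (p - 1) * S ^ (2 - n * (p - 1)) * k
      = k * S ^ (-(n * (p - 1))) * A ^ (p - 1) * S ^ 2 := by
        rw [show (2 : ℝ) - n * (p - 1) = -(n * (p - 1)) + 2 by ring, Real.rpow_add hS0,
          Real.rpow_two]
        ring
    _ ≤ K := hblowup m (ε * I) S _ A Y Z r hm h.ode (by positivity) h.init h.init_deriv hS
        (by positivity) hA hforce hAY

section LowerBounds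

variable {ε b : ℝ} {Y Z r : ℝ → ℝ}

lemma mul_rpow_le (hm : m * (m + 1 - μ) = 0) (h : MassODE n μ p m I c₀ c₁ ε b Y Z r) :
    ∀ s ∈ Set.Icc 1 b, ε * I * s ^ (-m) ≤ Y s :=
  h.ode.mul_rpow_le hm h.init h.init_deriv

lemma exists_power_lower (hμ : 0 ≤ μ) (hm : m * (m + 1 - μ) = 0) (hc₁ : 0 < c₁) :
    ∃ c : ℝ, 0 < c ∧ ∀ (ε b : ℝ) (Y Z r : ℝ → ℝ), 0 < ε →
      MassODE n μ p m I c₀ c₁ ε b Y Z r → ∀ s ∈ Set.Icc 2 b,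
        ε * I * s ^ (-m) + c * ε ^ p * s ^ ((n : ℝ) + 1 - (n + μ - 1) * p / 2) ≤ Y s := by
  obtain ⟨a, ha⟩ : ∃ a, a = (n : ℝ) - 1 - (n + μ - 1) * p / 2 := ⟨_, rfl⟩
  refine ⟨(1 / 2) ^ μ * c₁ / 2 ^ |a| / 8, by positivity, fun ε b Y Z r hε h s hs => ?_⟩
  have hs0 : 0 < s := two_pos.trans_le hs.1
  have hforce : ∀ x ∈ Set.Ioo (s / 2) s, c₁ * ε ^ p * (s ^ a / 2 ^ |a|) ≤ r x := by
    intro x hx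
    have hx1 : 1 < x := by linarith [hx.1, hs.1]
    refine le_trans ?_ (h.le_of_data x ⟨hx1, hx.2.le.trans hs.2⟩)
    rw [← ha]
    gcongr
    exact (div_le_iff₀' (by positivity)).2 (rpow_le_rpow_abs_mul a hs0 (one_pos.trans hx1)
      (by linarith [hx.1]) (by linarith [hx.2]))
  refine (le_of_eq ?_).trans (h.ode.mul_rpow_add_mul_sq_le hμ hm h.init h.init_deriv
    (by positivity) (by linarith [hs.1]) hs.2 hforce s ⟨by linarith, le_rfl⟩)
  rw [show (n : ℝ) + 1 - (n + μ - 1) * p / 2 = a + 2 by rw [ha]; ring, Real.rpow_add hs0,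
    Real.rpow_two, show s / 2 / s = 1 / 2 by field_simp]
  ring

lemma exists_const_lower (hμ : 0 ≤ μ) (hm : m * (m + 1 - μ) = 0) (hI : 0 ≤ I) (hc₁ : 0 < c₁) :
    ∃ c : ℝ, 0 < c ∧ ∀ (ε b : ℝ) (Y Z r : ℝ → ℝ), 0 < ε →
      MassODE n μ p m I c₀ c₁ ε b Y Z r → ∀ s ∈ Set.Icc 2 b, c * ε ^ p ≤ Y s := by
  obtain ⟨c, hc, hlower⟩ := exists_power_lower (n := n) (p := p) (I := I) (c₀ := c₀) hμ hm hc₁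
  refine ⟨c * 2 ^ ((n : ℝ) + 1 - (n + μ - 1) * p / 2), by positivity,
    fun ε b Y Z r hε h s hs => ?_⟩
  have hat_two := hlower ε b Y Z r hε h 2 ⟨le_rfl, hs.1.trans hs.2⟩
  have hmono := (h.ode.sub_mul_rpow hm (ε * I)).monotoneOn (by simp [h.init_deriv]) (by simp)
    ⟨one_le_two, hs.1.trans hs.2⟩ ⟨one_le_two.trans hs.1, hs.2⟩ hs.1
  have hs0 : 0 < s := two_pos.trans_le hs.1
  have : 0 ≤ ε * I * s ^ (-m) := by positivity
  linarith

lemma log_lower (hm : 0 < m) (hmμ : m + 1 = μ) (hp : (n + μ - 1) * p = 2 * (n + 1)) (hI : 0 ≤ I)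
    (hε : 0 < ε) (h : MassODE n μ p m I c₀ c₁ ε b Y Z r) :
    ∀ s ∈ Set.Icc 1 b, c₁ * ε ^ p / m * (Real.log s + (s ^ (-m) - 1) / m) ≤ Y s := by
  intro s hs
  have hforce : ∀ s ∈ Set.Ioo 1 b, c₁ * ε ^ p / m * m / s ^ 2 ≤ r s := fun s hs => by
    have hdata := h.le_of_data s ⟨hs.1, hs.2.le⟩
    rwa [hp, show (n : ℝ) - 1 - 2 * (n + 1) / 2 = -2 by ring, Real.rpow_neg
      (one_pos.trans hs.1).le, Real.rpow_two, ← div_eq_mul_inv, ← div_mul_cancel₀ (_ * _) hm.ne']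
      at hdata
  have hsub := h.ode.sub_mul_rpow (m := m) (by rw [hmμ]; ring) (ε * I)
  rw [← hmμ] at hsub
  have hmono := (hsub.sub_mul_log hm.ne' hforce).monotoneOn (by simp [h.init_deriv]) (by simp)
    (Set.left_mem_Icc.2 (hs.1.trans hs.2)) hs hs.1
  simp only [h.init, Real.one_rpow, Real.log_one, sub_self, zero_div, mul_one, add_zero,
    mul_zero] at hmono
  have hs0 : 0 < s := one_pos.trans_le hs.1
  have : 0 ≤ ε * I * s ^ (-m) := by positivity
  linarith

end LowerBounds

variable {c d α γ : ℝ}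

lemma exists_rpow_mul_rpow_le (hμ : 0 ≤ μ) (hp : 1 < p) (hm : m * (m + 1 - μ) = 0) (hI : 0 ≤ I)
    (hc₀ : 0 < c₀) (hc : 0 < c) (hγ : γ = α * (p - 1) + 2 - n * (p - 1))
    (hlow : ∀ (ε b : ℝ) (Y Z r : ℝ → ℝ), 0 < ε → MassODE n μ p m I c₀ c₁ ε b Y Z r →
      ∀ s ∈ Set.Icc 2 b, c * ε ^ d * s ^ α ≤ Y s) :
    ∃ K : ℝ, ∀ (ε S : ℝ) (Y Z r : ℝ → ℝ), 0 < ε → 2 ≤ S →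
      MassODE n μ p m I c₀ c₁ ε (2 * S) Y Z r → ε ^ (d * (p - 1)) * S ^ γ ≤ K := by
  obtain ⟨K, hblowup⟩ := exists_blowup_bound (n := n) (c₁ := c₁) hμ hp hm hI hc₀
  set k : ℝ := c / 2 ^ |α| with hk
  have hk0 : 0 < k := by positivity
  refine ⟨K / k ^ (p - 1), fun ε S Y Z r hε hS h => ?_⟩
  have hS0 : 0 < S := two_pos.trans_le hS
  have hlower : ∀ s ∈ Set.Icc S (2 * S), k * ε ^ d * S ^ α ≤ Y s := by
    intro s hs
    have hrpow : S ^ α ≤ 2 ^ |α| * s ^ α :=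
      rpow_le_rpow_abs_mul α hS0 (hS0.trans_le hs.1) (by linarith [hs.1]) hs.2
    calc k * ε ^ d * S ^ α ≤ k * ε ^ d * (2 ^ |α| * s ^ α) := by gcongr
      _ = c * ε ^ d * s ^ α := by rw [hk]; field_simp
      _ ≤ Y s := hlow ε _ Y Z r hε h s ⟨hS.trans hs.1, hs.2⟩
  rw [le_div_iff₀' (by positivity)]
  calc k ^ (p - 1) * (ε ^ (d * (p - 1)) * S ^ γ)
      = (k * ε ^ d * S ^ α) ^ (p - 1) * S ^ (2 - n * (p - 1)) := by
        rw [show γ = α * (p - 1) + (2 - n * (p - 1)) by rw [hγ]; ring, Real.rpow_add hS0,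
          Real.rpow_mul hε.le, Real.rpow_mul hS0.le,
          Real.mul_rpow (by positivity) (by positivity),
          Real.mul_rpow hk0.le (by positivity)]
        ring
    _ ≤ K := hblowup ε S _ Y Z r hε (by linarith) (by positivity) h hlower

lemma eventually_not_of_rpow_le (hμ : 0 ≤ μ) (hp : 1 < p) (hm : m * (m + 1 - μ) = 0) (hI : 0 ≤ I)
    (hc₀ : 0 < c₀) (hc : 0 < c) (hd : 0 ≤ d) (hγ : γ = α * (p - 1) + 2 - n * (p - 1))
    (hγ0 : 0 < γ)
    (hlow : ∀ (ε b : ℝ) (Y Z r : ℝ → ℝ), 0 < ε → MassODE n μ p m I c₀ c₁ ε b Y Z r →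
      ∀ s ∈ Set.Icc 2 b, c * ε ^ d * s ^ α ≤ Y s) :
    ∀ᶠ C : ℝ in atTop, ∀ ε : ℝ, 0 < ε → ε ≤ 1 → ∀ Y Z r : ℝ → ℝ,
      ¬ MassODE n μ p m I c₀ c₁ ε (1 + C * ε ^ (-(d * (p - 1) / γ))) Y Z r := by
  obtain ⟨K, hK⟩ := exists_rpow_mul_rpow_le hμ hp hm hI hc₀ hc hγ hlow
  have hlarge : ∀ᶠ C : ℝ in atTop, K < (C / 2) ^ γ :=
    ((tendsto_rpow_atTop hγ0).comp (tendsto_id.atTop_div_const two_pos)).eventually_gt_atTop K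
  filter_upwards [eventually_ge_atTop 3, hlarge] with C hC hKC ε hε hε1 Y Z r h
  set e : ℝ := d * (p - 1) / γ with he
  have he0 : 0 ≤ e := div_nonneg (mul_nonneg hd (by linarith)) hγ0.le
  have hεe : 1 ≤ ε ^ (-e) := Real.one_le_rpow_of_pos_of_le_one_of_nonpos hε hε1 (by linarith)
  obtain ⟨S, hS⟩ : ∃ S, 1 + C * ε ^ (-e) = 2 * S := ⟨(1 + C * ε ^ (-e)) / 2, by ring⟩
  have hbound := hK ε S Y Z r hε (by nlinarith) (hS ▸ h)
  refine hbound.not_gt (hKC.trans_le ?_)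
  calc (C / 2) ^ γ = ε ^ (d * (p - 1)) * (C / 2 * ε ^ (-e)) ^ γ := by
        rw [Real.mul_rpow (by linarith) (by positivity), ← Real.rpow_mul hε.le,
          show -e * γ = -(d * (p - 1)) by rw [he]; field_simp, Real.rpow_neg hε.le]
        field_simp
    _ ≤ ε ^ (d * (p - 1)) * S ^ γ := by
        have : C / 2 * ε ^ (-e) ≤ S := by linarith
        gcongr

lemma eventually_not_of_gammaF_add_pos (hμ : 0 ≤ μ) (hp : 1 < p) (hm : m * (m + 1 - μ) = 0)
    (hI : 0 < I) (hc₀ : 0 < c₀) (hγ : 0 < gammaF p (n + m)) :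
    ∀ᶠ C : ℝ in atTop, ∀ ε : ℝ, 0 < ε → ε ≤ 1 → ∀ Y Z r : ℝ → ℝ,
      ¬ MassODE n μ p m I c₀ c₁ ε (1 + C * ε ^ (-((p - 1) / gammaF p (n + m)))) Y Z r := by
  simpa only [one_mul] using eventually_not_of_rpow_le hμ hp hm hI.le hc₀ hI zero_le_one
    (α := -m) (by rw [gammaF]; ring) hγ fun ε b Y Z r _ h s hs => by
      rw [Real.rpow_one, mul_comm I]
      exact h.mul_rpow_le hm s ⟨one_le_two.trans hs.1, hs.2⟩

lemma eventually_not_of_gammaF_pos (hμ : 0 ≤ μ) (hp : 1 < p) (hm : m * (m + 1 - μ) = 0)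
    (hI : 0 ≤ I) (hc₀ : 0 < c₀) (hc₁ : 0 < c₁) (hγ : 0 < gammaF p n) :
    ∀ᶠ C : ℝ in atTop, ∀ ε : ℝ, 0 < ε → ε ≤ 1 → ∀ Y Z r : ℝ → ℝ,
      ¬ MassODE n μ p m I c₀ c₁ ε (1 + C * ε ^ (-(p * (p - 1) / gammaF p n))) Y Z r := by
  obtain ⟨c, hc, hlower⟩ :=
    exists_const_lower (n := n) (p := p) (I := I) (c₀ := c₀) hμ hm hI hc₁
  exact eventually_not_of_rpow_le hμ hp hm hI hc₀ hc (one_pos.trans hp).le (α := 0)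
    (by rw [gammaF]; ring) hγ fun ε b Y Z r hε h s hs => by
      simpa only [Real.rpow_zero, mul_one] using hlower ε b Y Z r hε h s hs

lemma eventually_not_of_gammaS_pos (hμ : 0 ≤ μ) (hp : 1 < p) (hm : m * (m + 1 - μ) = 0)
    (hI : 0 ≤ I) (hc₀ : 0 < c₀) (hc₁ : 0 < c₁) (hγ : 0 < gammaS p (n + μ)) :
    ∀ᶠ C : ℝ in atTop, ∀ ε : ℝ, 0 < ε → ε ≤ 1 → ∀ Y Z r : ℝ → ℝ,
      ¬ MassODE n μ p m I c₀ c₁ ε (1 + C * ε ^ (-(2 * p * (p - 1) / gammaS p (n + μ)))) Y Z r := by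
  obtain ⟨c, hc, hlower⟩ :=
    exists_power_lower (n := n) (p := p) (I := I) (c₀ := c₀) hμ hm hc₁
  rw [show 2 * p * (p - 1) / gammaS p (n + μ) = p * (p - 1) / (gammaS p (n + μ) / 2) by field_simp]
  refine eventually_not_of_rpow_le hμ hp hm hI hc₀ hc (one_pos.trans hp).le
    (α := n + 1 - (n + μ - 1) * p / 2) (by rw [gammaS]; ring) (half_pos hγ)
    fun ε b Y Z r hε h s hs => le_trans ?_ (hlower ε b Y Z r hε h s hs)
  have hs0 : 0 < s := two_pos.trans_le hs.1
  exact le_add_of_nonneg_left (by positivity)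

end MassODE

/-! ### The critical case -/

lemma strictMonoOn_rpow_mul_log {θ : ℝ} (hθ : 0 < θ) :
    StrictMonoOn (fun x : ℝ => x ^ θ * Real.log (1 + x)) (Set.Ici 0) := by
  intro x hx y _ hxy
  have hx0 : 0 ≤ x := hx
  exact mul_lt_mul'' (Real.rpow_lt_rpow hx0 hxy hθ)
    (Real.log_lt_log (by linarith) (by linarith)) (by positivity) (Real.log_nonneg (by linarith))

lemma existsUnique_isSigmaZero {n : ℕ} {p ε : ℝ} (hθ : 0 < 2 / (p - 1) - n) (hε : 0 < ε) :
    ∃! σ : ℝ, IsSigmaZero n p ε σ := by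
  have hεp : 0 < ε ^ p := by positivity
  have hiff : ∀ σ : ℝ, IsSigmaZero n p ε σ ↔
      0 < σ ∧ σ ^ (2 / (p - 1) - n) * Real.log (1 + σ) = (ε ^ p)⁻¹ := fun σ => by
    rw [IsSigmaZero, mul_assoc, mul_comm (ε ^ p), mul_eq_one_iff_eq_inv₀ hεp.ne']
  simp only [hiff]
  have hcont : ContinuousOn (fun x : ℝ => x ^ (2 / (p - 1) - n) * Real.log (1 + x))
      (Set.Ici 0) := by
    refine (continuousOn_id.rpow_const fun x _ => Or.inr hθ.le).mul
      (ContinuousOn.log (by fun_prop) fun x hx => ?_)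
    have : 0 ≤ x := hx
    positivity
  have htends : Tendsto (fun x : ℝ => x ^ (2 / (p - 1) - n) * Real.log (1 + x)) atTop atTop :=
    (tendsto_rpow_atTop hθ).atTop_mul_atTop₀
      (Real.tendsto_log_atTop.comp (tendsto_atTop_add_const_left _ 1 tendsto_id))
  obtain ⟨σ, hσ0, hσ⟩ := isPreconnected_Ici.intermediate_value_Ici Set.self_mem_Ici
    (le_principal_iff.2 (Ici_mem_atTop 0)) hcont htends
    (show (ε ^ p)⁻¹ ∈ Set.Ici _ by simpa using hεp.le)
  have hσ_pos : 0 < σ := by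
    refine lt_of_le_of_ne hσ0 ?_
    rintro rfl
    simp [hεp.ne] at hσ
  exact ⟨σ, ⟨hσ_pos, hσ⟩, fun x hx =>
    (strictMonoOn_rpow_mul_log hθ).injOn (Set.mem_Ici.2 hx.1.le) hσ0 (hx.2.trans hσ.symm)⟩

lemma IsSigmaZero.one_le {n : ℕ} {p ε σ : ℝ} (hp : 0 ≤ p) (hθ : 0 < 2 / (p - 1) - n) (hε : 0 < ε)
    (hε1 : ε ≤ 1) (h : IsSigmaZero n p ε σ) : 1 ≤ σ := by
  obtain ⟨hσ0, hσ⟩ := h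
  by_contra! hσ1
  have hlt :=
    strictMonoOn_rpow_mul_log hθ (Set.mem_Ici.2 hσ0.le) (Set.mem_Ici.2 zero_le_one) hσ1
  have hlog : Real.log 2 < 1 := Real.log_two_lt_d9.trans (by norm_num)
  have hεp : ε ^ p ≤ 1 := Real.rpow_le_one hε.le hε1 hp
  have hεp0 : 0 < ε ^ p := by positivity
  simp only [Real.one_rpow, one_mul, one_add_one_eq_two] at hlt
  nlinarith

namespace MassODE

variable {n : ℕ} {μ p m I c₀ c₁ : ℝ}

lemma exists_rpow_mul_log_le (hm : 0 < m) (hmμ : m + 1 = μ) (hp : 1 < p)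
    (hpc : (n + μ - 1) * p = 2 * (n + 1)) (hI : 0 ≤ I) (hc₀ : 0 < c₀) (hc₁ : 0 < c₁) :
    ∃ K : ℝ, ∀ (ε S : ℝ) (Y Z r : ℝ → ℝ), 0 < ε → Real.exp (2 / m) ≤ S →
      MassODE n μ p m I c₀ c₁ ε (2 * S) Y Z r →
      ε ^ p * S ^ (2 / (p - 1) - n) * Real.log S ≤ K := by
  have hp1 : 0 < p - 1 := sub_pos.2 hp
  obtain ⟨K, hblowup⟩ :=
    exists_blowup_bound (n := n) (c₁ := c₁) (by linarith : 0 ≤ μ) hp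
      (by rw [hmμ]; ring : m * (m + 1 - μ) = 0) hI hc₀
  set k : ℝ := c₁ / (2 * m) with hk
  have hk0 : 0 < k := by positivity
  refine ⟨K ^ (p - 1)⁻¹ / k, fun ε S Y Z r hε hS h => ?_⟩
  have hS0 : 0 < S := (Real.exp_pos _).trans_le hS
  have hlogS : 2 / m ≤ Real.log S := (Real.le_log_iff_exp_le hS0).2 hS
  have hlogS0 : 0 < Real.log S := (by positivity : 0 < 2 / m).trans_le hlogS
  have hS1 : 1 ≤ S := ((Real.log_pos_iff hS0.le).1 hlogS0).le
  have hlower : ∀ s ∈ Set.Icc S (2 * S), k * ε ^ p * Real.log S ≤ Y s := by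
    intro s hs
    have hs0 : 0 < s := hS0.trans_le hs.1
    have hhalf : Real.log S / 2 ≤ Real.log s + (s ^ (-m) - 1) / m := by
      have hlog : Real.log S ≤ Real.log s := Real.log_le_log hS0 hs.1
      have hneg : -1 / m ≤ (s ^ (-m) - 1) / m := by
        gcongr
        linarith [Real.rpow_pos_of_pos hs0 (-m)]
      have : 2 / m = -2 * (-1 / m) := by ring
      linarith
    calc k * ε ^ p * Real.log S = c₁ * ε ^ p / m * (Real.log S / 2) := by rw [hk]; field_simp
      _ ≤ c₁ * ε ^ p / m * (Real.log s + (s ^ (-m) - 1) / m) := by gcongr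
      _ ≤ Y s := h.log_lower hm hmμ hpc hI hε s ⟨hS1.trans hs.1, hs.2⟩
  have hbound := hblowup ε S _ Y Z r hε hS1 (by positivity) h hlower
  rw [show 2 - n * (p - 1) = (2 / (p - 1) - n) * (p - 1) by field_simp, Real.rpow_mul hS0.le,
    ← Real.mul_rpow (by positivity) (by positivity)] at hbound
  rw [le_div_iff₀' hk0]
  calc k * (ε ^ p * S ^ (2 / (p - 1) - n) * Real.log S)
      = k * ε ^ p * Real.log S * S ^ (2 / (p - 1) - n) := by ring
    _ ≤ K ^ (p - 1)⁻¹ :=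
      (Real.le_rpow_inv_iff_of_pos (by positivity) ((by positivity : (0 : ℝ) ≤ _).trans hbound)
        hp1).2 hbound

lemma eventually_not_of_isSigmaZero (hm : 0 < m) (hmμ : m + 1 = μ) (hp : 1 < p)
    (hpc : (n + μ - 1) * p = 2 * (n + 1)) (hI : 0 ≤ I) (hc₀ : 0 < c₀) (hc₁ : 0 < c₁)
    (hθ : 0 < 2 / (p - 1) - n) :
    ∀ᶠ C : ℝ in atTop, ∀ ε σ : ℝ, 0 < ε → ε ≤ 1 → IsSigmaZero n p ε σ → ∀ Y Z r : ℝ → ℝ,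
      ¬ MassODE n μ p m I c₀ c₁ ε (1 + C * σ) Y Z r := by
  obtain ⟨K, hK⟩ := exists_rpow_mul_log_le (n := n) hm hmμ hp hpc hI hc₀ hc₁
  obtain ⟨θ, hθ_eq⟩ : ∃ θ, θ = 2 / (p - 1) - n := ⟨_, rfl⟩
  rw [← hθ_eq] at hK
  have hlarge : ∀ᶠ C : ℝ in atTop, K < (C / 2) ^ θ :=
    ((tendsto_rpow_atTop (hθ_eq ▸ hθ)).comp
      (tendsto_id.atTop_div_const two_pos)).eventually_gt_atTop K
  filter_upwards [eventually_ge_atTop 4, eventually_ge_atTop (2 * Real.exp (2 / m)), hlarge]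
    with C hC4 hCm hKC ε σ hε hε1 hσ Y Z r h
  have hσ1 : 1 ≤ σ := hσ.one_le (one_pos.trans hp).le hθ hε hε1
  obtain ⟨hσ0, hσ⟩ := hσ
  rw [← hθ_eq] at hσ
  obtain ⟨S, hS⟩ : ∃ S, 1 + C * σ = 2 * S := ⟨(1 + C * σ) / 2, by ring⟩
  have hbound := hK ε S Y Z r hε (by nlinarith) (hS ▸ h)
  refine hbound.not_gt (hKC.trans_le ?_)
  calc (C / 2) ^ θ = (C / 2) ^ θ * (ε ^ p * σ ^ θ * Real.log (1 + σ)) := by rw [hσ, mul_one]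
    _ = ε ^ p * (C / 2 * σ) ^ θ * Real.log (1 + σ) := by
        rw [Real.mul_rpow (by linarith) hσ0.le]
        ring
    _ ≤ ε ^ p * S ^ θ * Real.log S := by
        have hSC : C / 2 * σ ≤ S := by linarith
        have hSσ : 1 + σ ≤ S := by nlinarith
        have := Real.log_nonneg (by linarith : 1 ≤ 1 + σ)
        have hS0 : 0 < S := by linarith
        have hθ0 : 0 ≤ θ := hθ_eq ▸ hθ.le
        gcongr

end MassODE

/-! ### The exponents -/

lemma gammaF_pos_of_lt_fujitaExp {p ν : ℝ} (hp : 1 < p) (h : (p : EReal) < fujitaExp ν) :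
    0 < gammaF p ν := by
  rw [gammaF, sub_pos]
  by_cases hν : 0 < ν
  · rw [fujitaExp, if_pos hν, EReal.coe_lt_coe_iff, ← sub_lt_iff_lt_add', lt_div_iff₀' hν] at h
    exact h
  · exact (mul_nonpos_of_nonpos_of_nonneg (not_lt.1 hν) (sub_pos.2 hp).le).trans_lt two_pos

lemma gammaS_pos_of_lt_straussExp {p ν : ℝ} (hν : 1 ≤ ν) (hp : 1 < p)
    (h : (p : EReal) < straussExp ν) : 0 < gammaS p ν := by
  rcases hν.eq_or_lt with rfl | hν
  · rw [gammaS]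
    linarith
  rw [straussExp, if_pos hν, EReal.coe_lt_coe_iff, lt_div_iff₀ (by linarith)] at h
  have hdisc : 0 ≤ ν ^ 2 + 10 * ν - 7 := by nlinarith
  have hleft : -√(ν ^ 2 + 10 * ν - 7) < 2 * (ν - 1) * p - (ν + 1) := by
    have : 3 - ν ≤ √(ν ^ 2 + 10 * ν - 7) := Real.le_sqrt_of_sq_le (by linarith)
    nlinarith
  have hsq : (2 * (ν - 1) * p - (ν + 1)) ^ 2 < ν ^ 2 + 10 * ν - 7 :=
    Real.sq_sqrt hdisc ▸ sq_lt_sq' hleft (by linarith)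
  have hcomplete : 4 * (ν - 1) * gammaS p ν =
      ν ^ 2 + 10 * ν - 7 - (2 * (ν - 1) * p - (ν + 1)) ^ 2 := by
    rw [gammaS]
    ring
  exact pos_of_mul_pos_right (hcomplete ▸ sub_pos.2 hsq) (by linarith)

lemma gammaF_antitone {ν : ℝ} (hν : 0 ≤ ν) : Antitone fun p => gammaF p ν := by
  intro p q hpq
  simp only [gammaF]
  gcongr

lemma gammaS_pos_of_gammaF_pos {p ν : ℝ} (hp : 1 < p) (h : 0 < gammaF p (ν - 1)) :
    0 < gammaS p ν := by
  have : gammaS p ν = 2 + p * gammaF p (ν - 1) := by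
    rw [gammaS, gammaF]
    ring
  rw [this]
  positivity

lemma gammaS_eq_two_mul_gammaF_add (p ν μ : ℝ) :
    gammaS p (ν + μ) = 2 * gammaF p ν + (p - 1) * (2 * (ν + 1) - (ν + μ - 1) * p) := by
  rw [gammaS, gammaF]
  ring

variable {n : ℕ} {μ p : ℝ}

lemma add_sub_one_mul_pStar (h : 0 < n + μ - 1) : (n + μ - 1) * pStar n μ = 2 * (n + 1) := by
  rw [pStar]
  field_simp
  ring

lemma gammaF_pStar_pos_iff (h : 0 < n + μ - 1) :
    0 < gammaF (pStar n μ) n ↔ muStar n < μ := by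
  rw [gammaF, pStar, add_sub_cancel_left, sub_pos, muStar, mul_div_assoc', div_lt_iff₀ h,
    div_lt_iff₀ (by positivity)]
  constructor <;> intro h <;> linarith

lemma one_le_muStar (n : ℕ) : 1 ≤ muStar n := by
  rw [muStar, le_div_iff₀ (by positivity)]
  nlinarith [sq_nonneg (n : ℝ)]

lemma gammaS_pos_of_lt_pStar (hn : 1 ≤ n) (hp : 1 < p) (hμ : muStar n < μ) (h : p < pStar n μ) :
    0 < gammaS p (n + μ) := by
  have hn' : (1 : ℝ) ≤ n := by exact_mod_cast hn
  have hnμ : 0 < n + μ - 1 := by linarith [one_le_muStar n]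
  have hF : 0 < gammaF p n :=
    ((gammaF_pStar_pos_iff hnμ).2 hμ).trans_le (gammaF_antitone n.cast_nonneg h.le)
  have hlt : (n + μ - 1) * p < 2 * (n + 1) := add_sub_one_mul_pStar hnμ ▸ by gcongr
  rw [gammaS_eq_two_mul_gammaF_add]
  exact add_pos (by positivity) (mul_pos (by linarith) (by linarith))

lemma gammaS_pos_of_le_muStar (hn : 1 ≤ n) (hμ : 0 ≤ μ) (hp : 1 < p)
    (h : (p : EReal) < critExp n μ) (hμs : μ ≤ muStar n) : 0 < gammaS p (n + μ) := by
  have hn' : (1 : ℝ) ≤ n := by exact_mod_cast hn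
  rcases lt_max_iff.1 h with h | h
  · have hF := gammaF_pos_of_lt_fujitaExp hp h
    rcases le_total μ 1 with hμ1 | hμ1
    · rw [negPart_eq_neg.2 (by linarith)] at hF
      exact gammaS_pos_of_gammaF_pos hp (by convert hF using 2; ring)
    · rw [negPart_eq_zero.2 (by linarith), sub_zero] at hF
      have hnμ : 0 < n + μ - 1 := by linarith
      have hps : p ≤ pStar n μ := by
        by_contra! hps
        exact hμs.not_gt ((gammaF_pStar_pos_iff hnμ).1
          (hF.trans_le (gammaF_antitone n.cast_nonneg hps.le)))
      have hle : (n + μ - 1) * p ≤ 2 * (n + 1) := add_sub_one_mul_pStar hnμ ▸ by gcongr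
      rw [gammaS_eq_two_mul_gammaF_add]
      exact add_pos_of_pos_of_nonneg (by positivity) (mul_nonneg (by linarith) (by linarith))
  · exact gammaS_pos_of_lt_straussExp (by linarith) hp h

lemma gammaF_pos_of_pStar_lt (hn : 1 ≤ n) (hp : 1 < p) (hμ1 : 1 ≤ μ)
    (h : (p : EReal) < critExp n μ) (hps : pStar n μ < p) : 0 < gammaF p n := by
  have hn' : (1 : ℝ) ≤ n := by exact_mod_cast hn
  rcases lt_max_iff.1 h with h | h
  · rw [negPart_eq_zero.2 (by linarith), sub_zero] at h
    exact gammaF_pos_of_lt_fujitaExp hp h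
  · have hnμ : 0 < n + μ - 1 := by linarith
    have hlt : 2 * (n + 1) < (n + μ - 1) * p := add_sub_one_mul_pStar hnμ ▸ by gcongr
    have hS := gammaS_pos_of_lt_straussExp (by linarith) hp h
    rw [gammaS_eq_two_mul_gammaF_add] at hS
    linarith [mul_neg_of_pos_of_neg (sub_pos.2 hp) (sub_neg.2 hlt)]

lemma pStar_le_one (hn : 1 ≤ n) (h : n + 3 ≤ μ) : pStar n μ ≤ 1 := by
  have hn' : (1 : ℝ) ≤ n := by exact_mod_cast hn
  rw [pStar, add_le_iff_nonpos_right]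
  exact div_nonpos_of_nonpos_of_nonneg (by linarith) (by linarith)

lemma gammaF_one_add_posPart_pos (hp : 1 < p) (h : p < 2 / (1 + |μ - 1|)) :
    0 < gammaF p (1 + (μ - 1)⁺) := by
  have hle : (μ - 1)⁺ ≤ |μ - 1| := sup_le (le_abs_self _) (abs_nonneg _)
  have hnonneg : 0 ≤ (μ - 1)⁺ := posPart_nonneg _
  rw [lt_div_iff₀' (by positivity)] at h
  rw [gammaF, sub_pos]
  calc (1 + (μ - 1)⁺) * (p - 1) ≤ (1 + |μ - 1|) * p := by gcongr; linarith
    _ < 2 := h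

lemma posPart_mul_posPart_add_one_sub (μ : ℝ) : (μ - 1)⁺ * ((μ - 1)⁺ + 1 - μ) = 0 := by
  rcases le_total 1 μ with h | h
  · rw [posPart_eq_self.2 (sub_nonneg.2 h)]
    ring
  · rw [posPart_eq_zero.2 (sub_nonpos.2 h), zero_mul]

lemma eventually_exists_isSigmaZero_not_massODE {I c₀ c₁ : ℝ} (hn : 1 ≤ n) (hp : 1 < p)
    (hμ : muStar n < μ) (hps : p = pStar n μ) (hI : 0 ≤ I) (hc₀ : 0 < c₀) (hc₁ : 0 < c₁) :
    ∀ᶠ C : ℝ in atTop, ∀ ε : ℝ, 0 < ε → ε ≤ 1 →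
      ∃ σ : ℝ, IsSigmaZero n p ε σ ∧ (∀ s : ℝ, IsSigmaZero n p ε s → s = σ) ∧
        ∀ Y Z r : ℝ → ℝ, ¬ MassODE n μ p (μ - 1)⁺ I c₀ c₁ ε (1 + C * σ) Y Z r := by
  have hn' : (1 : ℝ) ≤ n := by exact_mod_cast hn
  have hμ1 : 1 < μ := (one_le_muStar n).trans_lt hμ
  have hnμ : 0 < n + μ - 1 := by linarith
  have hθ : 0 < 2 / (p - 1) - n := by
    rw [sub_pos, lt_div_iff₀ (sub_pos.2 hp), ← sub_pos]
    exact hps ▸ (gammaF_pStar_pos_iff hnμ).2 hμ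
  have hpc : (n + μ - 1) * p = 2 * (n + 1) := hps ▸ add_sub_one_mul_pStar hnμ
  rw [posPart_eq_self.2 (sub_pos.2 hμ1).le]
  filter_upwards [MassODE.eventually_not_of_isSigmaZero (sub_pos.2 hμ1) (sub_add_cancel μ 1) hp
    hpc hI hc₀ hc₁ hθ] with C hC ε hε hε1
  obtain ⟨σ, hσ, hunique⟩ := existsUnique_isSigmaZero hθ hε
  exact ⟨σ, hσ, hunique, hC ε σ hε hε1 hσ⟩

end

end DampedWave

theorem theorem1p4 (n : ℕ) (hn : 1 ≤ n) (μ p R : ℝ) (hμ : 0 ≤ μ)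
    (hp : 1 < p) (hp' : (p : EReal) < DampedWave.critExp n μ) (hR : 1 ≤ R)
    (f g : DampedWave.Space n → ℝ) (hf : DampedWave.MemH1 f) (hg : MemLp g 2 volume)
    (hf_nonneg : ∀ᵐ x, 0 ≤ f x) (hf_ne : ¬ ∀ᵐ x, f x = 0)
    (hfg : ∀ᵐ x, (μ - 1)⁺ * f x + g x = 0) :
    ∃ ε₃ : ℝ, 0 < ε₃ ∧ ∃ C : ℝ, 0 < C ∧ ∀ ε : ℝ, 0 < ε → ε ≤ ε₃ →
      (μ ≤ DampedWave.muStar n →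
        DampedWave.lifespan μ p R f g ε ≤
          ENNReal.ofReal (C * ε ^ (-(2 * p * (p - 1) / DampedWave.gammaS p (n + μ))))) ∧
      (DampedWave.muStar n < μ → μ < n + 3 →
        (p < DampedWave.pStar n μ →
          DampedWave.lifespan μ p R f g ε ≤
            ENNReal.ofReal (C * ε ^ (-(2 * p * (p - 1) / DampedWave.gammaS p (n + μ))))) ∧
        (p = DampedWave.pStar n μ →
          ∃ σ₀ : ℝ, DampedWave.IsSigmaZero n p ε σ₀ ∧
            (∀ s : ℝ, DampedWave.IsSigmaZero n p ε s → s = σ₀) ∧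
            DampedWave.lifespan μ p R f g ε ≤ ENNReal.ofReal (C * σ₀)) ∧
        (DampedWave.pStar n μ < p →
          DampedWave.lifespan μ p R f g ε ≤
            ENNReal.ofReal (C * ε ^ (-(p * (p - 1) / DampedWave.gammaF p n))))) ∧
      (n + 3 ≤ μ →
        DampedWave.lifespan μ p R f g ε ≤
          ENNReal.ofReal (C * ε ^ (-(p * (p - 1) / DampedWave.gammaF p n)))) ∧
      (n = 1 → 0 < μ → μ < 2 → p < 2 / (1 + |μ - 1|) →
        DampedWave.lifespan μ p R f g ε ≤
          ENNReal.ofReal (C * ε ^ (-((p - 1) / DampedWave.gammaF p (1 + (μ - 1)⁺))))) := by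
  open DampedWave in
  have hm := posPart_mul_posPart_add_one_sub μ
  obtain ⟨I, c₀, c₁, hI, hc₀, hc₁, hlife⟩ := exists_lifespan_le_of_forall_not_massODE hn hp hR hm
    (hf.1.locallyIntegrable one_le_two) hf_nonneg hf_ne hfg
  obtain ⟨C, hC, hstrauss, hfujita, hcrit, hline⟩ := ((eventually_gt_atTop 0).and <|
    (eventually_imp_distrib_left.2 <| MassODE.eventually_not_of_gammaS_pos (n := n) hμ hp hm
      hI.le hc₀ hc₁).and <|
    (eventually_imp_distrib_left.2 <| MassODE.eventually_not_of_gammaF_pos (n := n) hμ hp hm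
      hI.le hc₀ hc₁).and <|
    (eventually_imp_distrib_left.2 fun h : muStar n < μ ∧ p = pStar n μ =>
      eventually_exists_isSigmaZero_not_massODE hn hp h.1 h.2 hI.le hc₀ hc₁).and <|
    eventually_imp_distrib_left.2 <| MassODE.eventually_not_of_gammaF_add_pos (n := n) (c₁ := c₁)
      hμ hp hm hI hc₀).exists
  refine ⟨1, one_pos, C, hC, fun ε hε hε1 => ⟨fun hμs => ?_, fun hμs _ =>
    ⟨fun hps => ?_, fun hps => ?_, fun hps => ?_⟩, fun hμn => ?_, fun hn1 _ _ hpl => ?_⟩⟩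
  · exact hlife ε _ hε (by positivity)
      (hstrauss (gammaS_pos_of_le_muStar hn hμ hp hp' hμs) ε hε hε1)
  · exact hlife ε _ hε (by positivity) (hstrauss (gammaS_pos_of_lt_pStar hn hp hμs hps) ε hε hε1)
  · obtain ⟨σ, hσ, hunique, hnot⟩ := hcrit ⟨hμs, hps⟩ ε hε hε1
    exact ⟨σ, hσ, hunique, hlife ε _ hε (mul_pos hC hσ.1).le hnot⟩
  · have hμ1 : 1 ≤ μ := (one_le_muStar n).trans hμs.le
    exact hlife ε _ hε (by positivity)
      (hfujita (gammaF_pos_of_pStar_lt hn hp hμ1 hp' hps) ε hε hε1)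
  · have hμ1 : 1 ≤ μ := by linarith [(n.cast_nonneg : (0 : ℝ) ≤ n)]
    exact hlife ε _ hε (by positivity) (hfujita
      (gammaF_pos_of_pStar_lt hn hp hμ1 hp' ((pStar_le_one hn hμn).trans_lt hp)) ε hε hε1)
  · subst hn1
    rw [Nat.cast_one] at hline
    exact hlife ε _ hε (by positivity) (hline (gammaF_one_add_posPart_pos hp hpl) ε hε hε1)
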